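/- **Theorem (insertion is a pushout).** Consider the dependent type theory $\mathsf{Catt}$ for weak $\infty$-categories: its types are $\star$ and $s \to_A t$, its terms are variables and coherences $\mathrm{Coh}_{(\Delta;A)}[\sigma]$ over pasting contexts $\Delta$. Let $\mathcal R$ be a set of equality generators $(\Gamma,s,t)$ (two terms $s,t$ over a context $\Gamma$), and let $\mathsf{Catt}_{\mathcal R}$ be $\mathsf{Catt}$ with the definitional equality generated by the rules "$\Gamma\vdash s=t$ whenever $(\Gamma,s,t)\in\mathcal R$ and $\Gamma\vdash s:A$", together with the conversion rule. Assume that $\mathcal R$ is *tame*, i.e. for every $(\Gamma,s,t)\in\mathcal R$: (lifting) $\Gamma,A\vdash s=t$ whenever $s$ is well-typed over $\Gamma,A$; (substitution) $\Delta\vdash s[\sigma]=t[\sigma]$ whenever $\Delta\vdash\sigma:\Gamma$ and $s[\sigma]$ is well-typed over $\Delta$; (suspension) $\Sigma\Gamma\vdash\Sigma s=\Sigma t$ whenever $\Sigma s$ is well-typed over $\Sigma\Gamma$. Write $\mathsf{Catt}_{\mathcal R}$ also for the category of well-typed contexts and well-typed substitutions modulo definitional equality, where a substitution $\sigma:\Delta\to\Gamma$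 sends the variables of $\Delta$ to terms over $\Gamma$. A planar rooted tree is a finite list $T=[T_1,\dots,T_m]$ of planar rooted trees; it is identified with the pasting context $\Sigma T_1\vee\dots\vee\Sigma T_m$ (a single variable of type $\star$ if $m=0$). Its dimension is $\dim[\,]=0$, $\dim[T_1,\dots,T_m]=1+\max_i\dim T_i$; its trunk height is $\mathrm{th}([T_1])=1+\mathrm{th}(T_1)$ and $0$ if $m\neq1$; it is linear if $\mathrm{th}(T)=\dim T$, in which case its context is the disc context $D^{\dim T}$. A branch $P$ of a tree $S$ is a non-empty list of indices that leads to a linear subtree of $S$; it determines a variable of $S$, also written $P$, namely the top-dimensional variable of that subtree. Its branch height $\mathrm{bh}(P)$ is its length minus one, and its leaf height $\mathrm{lh}(P)$ is the dimension of the type $A$ of the variable $P$. For a type $B$ of dimension $n$ and a term $t$ over a context $\Gamma$, $\{B,t\}:D^n\to\Gamma$ is the substitution that sends $d_n$ to $t$ and the variables $d_k^\pm$ to the iterated sources and targets in $B$. The unbiased type $\mathcal U_T^n$ and unbiased coherence $\mathcal C_T^n=\mathrm{Coh}_{(T;\,\mathcal U_T^n)}[\mathrm{id}]$ of a tree $T$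 are defined by $\mathcal U_T^0=\star$ and $\mathcal U_T^{k+1}=\mathcal T^k_{\partial_kT}[\mathrm{inc}_k^-]\to_{\mathcal U_T^k}\mathcal T^k_{\partial_kT}[\mathrm{inc}_k^+]$, where $\mathrm{inc}^\pm_k:\partial_kT\to T$ are the inclusions of the $k$-dimensional boundary and $\mathcal T^k_B$ is the variable $d_k$ if $B=D^k$ and $\mathcal C^k_B$ otherwise. Let $S,T$ be trees and $P$ a branch of $S$ with $\mathrm{bh}(P)\le\mathrm{th}(T)$ and $\dim T\le n$, where $n:=\mathrm{lh}(P)$. The inserted tree $S\gg_PT$ is defined recursively: for $P=[k]$ it is $S$ with its $k$-th member $S_k$ replaced by the members of the list $T$; for $P=k::P'$ with $P'$ non-empty one has $T=[T_1]$, and $S_k$ is replaced by $S_k\gg_{P'}T_1$. The interior substitution $\iota:T\to S\gg_PT$ is the inclusion of $T$ if $P=[k]$, and is $\Sigma\iota_{S_k,P',T_1}$ followed by the inclusion if $P=k::P'$. The exterior substitution $\kappa:S\to S\gg_PT$ is the identity on the members of $S$ other than $S_k$; on $\Sigma S_k$ it is $\{\mathcal U_T^n,\mathcal C_T^n\}:\Sigma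 S_k=D^n\to T$ followed by the inclusion if $P=[k]$, and $\Sigma\kappa_{S_k,P',T_1}$ if $P=k::P'$. For $\sigma:S\to\Gamma$ and $\tau:T\to\Gamma$, given as labellings $s_0L_1s_1\cdots L_ms_m$ and $t_0M_1t_1\cdots M_lt_l$ of the trees by terms of $\Gamma$, the inserted substitution $\sigma\gg_P\tau:S\gg_PT\to\Gamma$ is the labelling obtained from that of $\sigma$ by replacing the part $s_{k-1}L_ks_k$ by the whole labelling of $\tau$ if $P=[k]$, and by $t_0\,(L_k\gg_{P'}M_1)\,t_1$ if $P=k::P'$. Then all contexts and substitutions in the square $$\begin{array}{ccc} D^n & \xrightarrow{\ \{A,P\}\ } & S\\ {\scriptstyle\{\mathcal U_T^n,\,\mathcal C_T^n\}}\big\downarrow & & \big\downarrow{\scriptstyle\kappa}\\ T & \xrightarrow{\ \ \iota\ \ } & S\gg_PT\end{array}$$ are well-typed, and the square is a pushout in the category $\mathsf{Catt}_{\mathcal R}$. Moreover, let $\Gamma$ be a well-typed context and let $\sigma:S\to\Gamma$, $\tau:T\to\Gamma$ be well-typed substitutions. If the terms $P[\sigma]$ and $\mathcal C_T^n[\tau]$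 are syntactically equal, then $\sigma$ and $\tau$ form a cocone, i.e. the composites $D^n\to S\xrightarrow{\sigma}\Gamma$ and $D^n\to T\xrightarrow{\tau}\Gamma$ agree in $\mathsf{Catt}_{\mathcal R}$. And whenever they form a cocone, the inserted substitution $\sigma\gg_P\tau$ is well-typed, and it is the morphism $S\gg_PT\to\Gamma$ induced by the universal property of the pushout. -/

import Mathlib

/-! Contexts, types, terms and substitutions of Catt, and the theories Catt_R. -/

namespace Catt

/-! ## Raw syntax

A context with `n` variables is an element of `Ctx n`. Types and terms over a context with `n`
variables are elements of `Ty n` and `Tm n`, and `Sub m n` consists of the substitutions from a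
context with `m` variables to a context with `n` variables. Variables are de Bruijn indices: in
`Fin2 (n + 1)` the most recently added variable is `.fz`. -/

mutual

inductive Ctx : ℕ → Type
  | nil : Ctx 0
  | snoc : {n : ℕ} → Ctx n → Ty n → Ctx (n + 1)

inductive Ty : ℕ → Type
  | star : {n : ℕ} → Ty n
  | arr : {n : ℕ} → Tm n → Ty n → Tm n → Ty n

inductive Tm : ℕ → Type
  | var : {n : ℕ} → Fin2 n → Tm n
  | coh : {m n : ℕ} → Ctx m → Ty m → Sub m n → Tm n

inductive Sub : ℕ → ℕ → Type
  | nil : {n : ℕ} → Sub 0 n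
  | snoc : {m n : ℕ} → Sub m n → Tm n → Sub (m + 1) n

end

/-! Weakening of types, terms and substitutions from `Γ` to a context `Γ, A`. -/

mutual

def Ty.wk : {n : ℕ} → Ty n → Ty (n + 1)
  | _, .star => .star
  | _, .arr s A t => .arr s.wk A.wk t.wk

def Tm.wk : {n : ℕ} → Tm n → Tm (n + 1)
  | _, .var i => .var (.fs i)
  | _, .coh Δ A σ => .coh Δ A σ.wk

def Sub.wk : {m n : ℕ} → Sub m n → Sub m (n + 1)
  | _, _, .nil => .nil
  | _, _, .snoc σ t => .snoc σ.wk t.wk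

end

/-- The type of a variable of a context, as a type over the whole context. -/
def Ctx.get : {n : ℕ} → Ctx n → Fin2 n → Ty n
  | _, .snoc _ A, .fz => A.wk
  | _, .snoc Γ _, .fs i => (Γ.get i).wk

/-- The term that a substitution assigns to a variable. -/
def Sub.get : {m n : ℕ} → Sub m n → Fin2 m → Tm n
  | _, _, .snoc _ t, .fz => t
  | _, _, .snoc σ _, .fs i => σ.get i

/-! The action of substitutions on types and terms, and composition of substitutions; `τ.comp σ`
is the composite `Θ → Δ → Γ` of `τ : Θ → Δ` and `σ : Δ → Γ`. -/

mutual

def Ty.sub : {m n : ℕ} → Ty m → Sub m n → Ty n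
  | _, _, .star, _ => .star
  | _, _, .arr s A t, σ => .arr (s.sub σ) (A.sub σ) (t.sub σ)

def Tm.sub : {m n : ℕ} → Tm m → Sub m n → Tm n
  | _, _, .var i, σ => σ.get i
  | _, _, .coh Δ A τ, σ => .coh Δ A (τ.comp σ)

def Sub.comp : {l m n : ℕ} → Sub l m → Sub m n → Sub l n
  | _, _, _, .nil, _ => .nil
  | _, _, _, .snoc τ t, σ => .snoc (τ.comp σ) (t.sub σ)

end

/-- The substitution sending each variable `i` to the variable `f i`. -/
def Sub.ren : {m n : ℕ} → (Fin2 m → Fin2 n) → Sub m n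
  | 0, _, _ => .nil
  | _ + 1, _, f => .snoc (Sub.ren fun i => f (.fs i)) (.var (f .fz))

/-- The identity substitution. -/
def Sub.id (n : ℕ) : Sub n n := Sub.ren fun i => i

/-- Transport of a substitution along an equality of the numbers of variables of its source. -/
def Sub.cast {m m' n : ℕ} (h : m = m') (σ : Sub m n) : Sub m' n := h ▸ σ

/-- Dimension of a type. -/
def Ty.dim : {n : ℕ} → Ty n → ℕ
  | _, .star => 0
  | _, .arr _ A _ => A.dim + 1

/-! Free variables. -/

mutual

def Ty.fv : {n : ℕ} → Ty n → Set (Fin2 n)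
  | _, .star => ∅
  | _, .arr s A t => s.fv ∪ A.fv ∪ t.fv

def Tm.fv : {n : ℕ} → Tm n → Set (Fin2 n)
  | _, .var i => {i}
  | _, .coh _ _ σ => σ.fv

def Sub.fv : {m n : ℕ} → Sub m n → Set (Fin2 n)
  | _, _, .nil => ∅
  | _, _, .snoc σ t => σ.fv ∪ t.fv

end

/-- A set of variables is downwards closed when it contains the free variables of the type of each
of its members. -/
def Ctx.DownClosed {n : ℕ} (Γ : Ctx n) (V : Set (Fin2 n)) : Prop :=
  ∀ i ∈ V, (Γ.get i).fv ⊆ V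

/-- The downward closure of a set of variables. -/
def Ctx.closure {n : ℕ} (Γ : Ctx n) (V : Set (Fin2 n)) : Set (Fin2 n) :=
  ⋂₀ {W | V ⊆ W ∧ Γ.DownClosed W}

/-- The support of a term. -/
def Tm.supp {n : ℕ} (Γ : Ctx n) (t : Tm n) : Set (Fin2 n) := Γ.closure t.fv

/-- The support of a substitution. -/
def Sub.supp {m n : ℕ} (Γ : Ctx n) (σ : Sub m n) : Set (Fin2 n) := Γ.closure σ.fv

/-! ## Suspension -/

/-- The variable `N` of a suspended context: the first one. -/
def northVar : (n : ℕ) → Fin2 (n + 2)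
  | 0 => .fs .fz
  | n + 1 => .fs (northVar n)

/-- The variable `S` of a suspended context: the second one. -/
def southVar : (n : ℕ) → Fin2 (n + 2)
  | 0 => .fz
  | n + 1 => .fs (southVar n)

/-- The copy in the suspension of a variable of a context. -/
def suspVar : {n : ℕ} → Fin2 n → Fin2 (n + 2)
  | _, .fz => .fz
  | _, .fs i => .fs (suspVar i)

mutual

def Ctx.susp : {n : ℕ} → Ctx n → Ctx (n + 2)
  | _, .nil => .snoc (.snoc .nil .star) .star
  | _, .snoc Γ A => .snoc Γ.susp A.susp

def Ty.susp : {n : ℕ} → Ty n → Ty (n + 2)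
  | n, .star => .arr (.var (northVar n)) .star (.var (southVar n))
  | _, .arr s A t => .arr s.susp A.susp t.susp

def Tm.susp : {n : ℕ} → Tm n → Tm (n + 2)
  | _, .var i => .var (suspVar i)
  | _, .coh Δ A σ => .coh Δ.susp A.susp σ.susp

def Sub.susp : {m n : ℕ} → Sub m n → Sub (m + 2) (n + 2)
  | _, n, .nil => .snoc (.snoc .nil (.var (northVar n))) (.var (southVar n))
  | _, _, .snoc σ t => .snoc σ.susp t.susp

end

/-! ## Wedge sums

For `Γ` with `a + 1` variables and `Δ` with `b + 1` variables, the wedge sum identifies the first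
variable of `Δ` with a chosen variable `x` of `Γ`, and has `a + b + 1` variables: those of `Γ`
followed by those of `Δ` except its first one. Below, `x` always is the last variable of type `⋆`
of `Γ`. -/

/-- The first variable of a nonempty context. -/
def firstVar : (n : ℕ) → Fin2 (n + 1)
  | 0 => .fz
  | n + 1 => .fs (firstVar n)

/-- The inclusion of the variables of `Γ` in `Γ ∨ Δ`. -/
def wedgeL {a : ℕ} : (b : ℕ) → Fin2 (a + 1) → Fin2 (a + b + 1)
  | 0, i => i
  | b + 1, i => .fs (wedgeL b i)

/-- The inclusion of the variables of `Δ` in `Γ ∨ Δ`. -/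
def wedgeR {a : ℕ} (x : Fin2 (a + 1)) : (b : ℕ) → Fin2 (b + 1) → Fin2 (a + b + 1)
  | 0, _ => x
  | _ + 1, .fz => .fz
  | b + 1, .fs i => .fs (wedgeR x b i)

/-- The wedge sum `Γ ∨ Δ` of contexts. -/
def Ctx.wedge {a : ℕ} (Γ : Ctx (a + 1)) (x : Fin2 (a + 1)) :
    (b : ℕ) → Ctx (b + 1) → Ctx (a + b + 1)
  | 0, _ => Γ
  | b + 1, .snoc Δ A => .snoc (Γ.wedge x b Δ) (A.sub (Sub.ren (wedgeR x b)))

/-- The substitution `Γ ∨ Δ → Θ` that is `σ` on `Γ` and `τ` on the variables of `Δ` other than the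
first one. -/
def Sub.copair {a k : ℕ} (σ : Sub (a + 1) k) : (b : ℕ) → Sub (b + 1) k → Sub (a + b + 1) k
  | 0, _ => σ
  | b + 1, .snoc τ t => .snoc (σ.copair b τ) t

/-- The substitution `σ ∨ τ : Γ ∨ Δ → Γ' ∨ Δ'`, where `Γ' ∨ Δ'` is formed along `x`. -/
def Sub.wedge {a b a' b' : ℕ} (σ : Sub (a + 1) (a' + 1)) (x : Fin2 (a' + 1))
    (τ : Sub (b + 1) (b' + 1)) : Sub (a + b + 1) (a' + b' + 1) :=
  Sub.copair (σ.comp (Sub.ren (wedgeL b'))) b (τ.comp (Sub.ren (wedgeR x b')))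

/-! ## Trees -/

/-- A planar rooted tree is a list of planar rooted trees: either the empty list `nil`, or the list
`cons T Ts` with first element `T` and tail `Ts`, itself a list of trees, hence a tree. -/
inductive Tree : Type
  | nil : Tree
  | cons : Tree → Tree → Tree

namespace Tree

/-- One less than the number of variables of the context generated by a tree. -/
def size : Tree → ℕ
  | nil => 0
  | cons T Ts => (T.size + 2) + Ts.size

/-- The context `Σ⌊T₁⌋ ∨ ⋯ ∨ Σ⌊Tₙ⌋` generated by a tree. The last variable of type `⋆` of a
suspension is `S`. -/
def ctx : (T : Tree) → Ctx (T.size + 1)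
  | nil => .snoc .nil .star
  | cons T Ts => Ctx.wedge (a := T.size + 2) T.ctx.susp (southVar (T.size + 1)) Ts.size Ts.ctx

/-- Dimension of a tree. -/
def dim : Tree → ℕ
  | nil => 0
  | cons T Ts => max (T.dim + 1) Ts.dim

/-- Trunk height of a tree. -/
def th : Tree → ℕ
  | cons T nil => T.th + 1
  | _ => 0

/-- A tree is linear if its trunk height equals its dimension. -/
def IsLinear (T : Tree) : Prop := T.th = T.dim

instance (T : Tree) : Decidable T.IsLinear := inferInstanceAs (Decidable (T.th = T.dim))

/-- Concatenation of trees, as lists. -/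
def append : Tree → Tree → Tree
  | nil, Ss => Ss
  | cons T Ts, Ss => cons T (Ts.append Ss)

/-- The last variable of type `⋆` of the context generated by a tree. -/
def lastVtx : (T : Tree) → Fin2 (T.size + 1)
  | nil => .fz
  | cons T Ts => wedgeR (a := T.size + 2) (southVar (T.size + 1)) Ts.size Ts.lastVtx

/-- The list of trees obtained by applying `f` to each member of a list of trees. -/
def map (f : Tree → Tree) : Tree → Tree
  | nil => nil
  | cons T Ts => cons (f T) (Ts.map f)

/-- The `n`-dimensional boundary of a tree. -/
def bdry : ℕ → Tree → Tree
  | 0 => fun _ => nil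
  | n + 1 => fun T => T.map (bdry n)

/-- The inclusion of the `n`-dimensional boundary of a tree, as source for `ε = false` and as target
for `ε = true`. -/
def inc (ε : Bool) : (n : ℕ) → (T : Tree) → Sub ((bdry n T).size + 1) (T.size + 1)
  | 0, T => .snoc .nil (.var (bif ε then T.lastVtx else firstVar T.size))
  | _ + 1, nil => Sub.id 1
  | n + 1, cons T Ts =>
    Sub.wedge (a := (bdry n T).size + 2) (a' := T.size + 2) (inc ε n T).susp
      (southVar (T.size + 1)) (inc ε (n + 1) Ts)

end Tree

/-! ## Typing and definitional equality -/

/-- A set of equality generators: triples `(Γ, s, t)` of a context and two terms over it. -/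
def RuleSet : Type := ∀ n : ℕ, Ctx n → Tm n → Tm n → Prop

/-! The judgements of Catt_R:
`WfCtx R Γ` is `Γ ⊢`, `WfTy R Γ A` is `Γ ⊢ A`, `HasTy R Γ t A` is `Γ ⊢ t : A`,
`WfSub R Γ σ Δ` is `Γ ⊢ σ : Δ` (for `σ : Δ → Γ`), and `EqTm R Γ s t`, `EqTy R Γ A B`,
`EqSub R Γ σ τ` are the definitional equalities over `Γ`. A pasting context is a context generated
by a tree. -/

mutual

inductive WfCtx (R : RuleSet) : {n : ℕ} → Ctx n → Prop
  | nil : WfCtx R Ctx.nil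
  | snoc {n : ℕ} {Γ : Ctx n} {A : Ty n} : WfCtx R Γ → WfTy R Γ A → WfCtx R (Γ.snoc A)

inductive WfTy (R : RuleSet) : {n : ℕ} → Ctx n → Ty n → Prop
  | star {n : ℕ} {Γ : Ctx n} : WfTy R Γ .star
  | arr {n : ℕ} {Γ : Ctx n} {s t : Tm n} {A : Ty n} :
      WfTy R Γ A → HasTy R Γ s A → HasTy R Γ t A → WfTy R Γ (.arr s A t)

inductive HasTy (R : RuleSet) : {n : ℕ} → Ctx n → Tm n → Ty n → Prop
  | var {n : ℕ} {Γ : Ctx n} (i : Fin2 n) : WfCtx R Γ → HasTy R Γ (.var i) (Γ.get i)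
  | comp {n : ℕ} {Γ : Ctx n} (T : Tree) (d : ℕ) {s t : Tm (T.size + 1)} {A : Ty (T.size + 1)}
      {σ : Sub (T.size + 1) n} : T.dim = d + 1 →
      WfTy R T.ctx (.arr s A t) → WfSub R Γ σ T.ctx →
      s.supp T.ctx = (T.inc false d).supp T.ctx →
      t.supp T.ctx = (T.inc true d).supp T.ctx →
      HasTy R Γ (.coh T.ctx (.arr s A t) σ) (.arr (s.sub σ) (A.sub σ) (t.sub σ))
  | full {n : ℕ} {Γ : Ctx n} (T : Tree) {s t : Tm (T.size + 1)} {A : Ty (T.size + 1)}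
      {σ : Sub (T.size + 1) n} :
      WfTy R T.ctx (.arr s A t) → WfSub R Γ σ T.ctx →
      s.supp T.ctx = Set.univ → t.supp T.ctx = Set.univ →
      HasTy R Γ (.coh T.ctx (.arr s A t) σ) (.arr (s.sub σ) (A.sub σ) (t.sub σ))
  | conv {n : ℕ} {Γ : Ctx n} {s : Tm n} {A B : Ty n} :
      HasTy R Γ s A → EqTy R Γ A B → HasTy R Γ s B

inductive WfSub (R : RuleSet) : {m n : ℕ} → Ctx n → Sub m n → Ctx m → Prop
  | nil {n : ℕ} {Γ : Ctx n} : WfSub R Γ .nil .nil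
  | snoc {m n : ℕ} {Γ : Ctx n} {Δ : Ctx m} {σ : Sub m n} {A : Ty m} {t : Tm n} :
      WfSub R Γ σ Δ → WfTy R Δ A → HasTy R Γ t (A.sub σ) → WfSub R Γ (σ.snoc t) (Δ.snoc A)

inductive EqTm (R : RuleSet) : {n : ℕ} → Ctx n → Tm n → Tm n → Prop
  | var {n : ℕ} {Γ : Ctx n} (i : Fin2 n) : EqTm R Γ (.var i) (.var i)
  | symm {n : ℕ} {Γ : Ctx n} {s t : Tm n} : EqTm R Γ s t → EqTm R Γ t s
  | trans {n : ℕ} {Γ : Ctx n} {s t u : Tm n} : EqTm R Γ s t → EqTm R Γ t u → EqTm R Γ s u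
  | coh {m n : ℕ} {Γ : Ctx n} {Δ : Ctx m} {A B : Ty m} {σ τ : Sub m n} :
      EqTy R Δ A B → EqSub R Γ σ τ → EqTm R Γ (.coh Δ A σ) (.coh Δ B τ)
  | rule {n : ℕ} {Γ : Ctx n} {s t : Tm n} {A : Ty n} :
      R n Γ s t → HasTy R Γ s A → EqTm R Γ s t

inductive EqTy (R : RuleSet) : {n : ℕ} → Ctx n → Ty n → Ty n → Prop
  | star {n : ℕ} {Γ : Ctx n} : EqTy R Γ .star .star
  | arr {n : ℕ} {Γ : Ctx n} {s s' t t' : Tm n} {A A' : Ty n} :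
      EqTm R Γ s s' → EqTm R Γ t t' → EqTy R Γ A A' → EqTy R Γ (.arr s A t) (.arr s' A' t')

inductive EqSub (R : RuleSet) : {m n : ℕ} → Ctx n → Sub m n → Sub m n → Prop
  | nil {n : ℕ} {Γ : Ctx n} : EqSub R Γ .nil .nil
  | snoc {m n : ℕ} {Γ : Ctx n} {σ τ : Sub m n} {s t : Tm n} :
      EqSub R Γ σ τ → EqTm R Γ s t → EqSub R Γ (σ.snoc s) (τ.snoc t)

end

/-- A set of equality generators is tame if it satisfies the lifting, substitution and suspension
conditions. -/
class RuleSet.Tame (R : RuleSet) : Prop where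
  lifting : ∀ {n : ℕ} {Γ : Ctx n} {s t : Tm n} (A : Ty n) (B : Ty (n + 1)), R n Γ s t →
    HasTy R (Γ.snoc A) s.wk B → EqTm R (Γ.snoc A) s.wk t.wk
  substitution : ∀ {m n : ℕ} {Γ : Ctx m} {s t : Tm m} {Δ : Ctx n} (σ : Sub m n) (C : Ty n),
    R m Γ s t → WfSub R Δ σ Γ → HasTy R Δ (s.sub σ) C → EqTm R Δ (s.sub σ) (t.sub σ)
  suspension : ∀ {n : ℕ} {Γ : Ctx n} {s t : Tm n} (A : Ty (n + 2)), R n Γ s t →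
    HasTy R Γ.susp s.susp A → EqTm R Γ.susp s.susp t.susp

/-! ## The category Catt_R

The facts below only serve to define it. -/

theorem Sub.ext_get : {m n : ℕ} → (σ τ : Sub m n) → (∀ i, σ.get i = τ.get i) → σ = τ
  | _, _, .nil, .nil, _ => rfl
  | _, _, .snoc σ s, .snoc τ t, h => by
    rw [Sub.ext_get σ τ fun i => h (.fs i)]
    exact congrArg _ (h .fz)

theorem Sub.get_ren : {m n : ℕ} → (f : Fin2 m → Fin2 n) → (i : Fin2 m) →
    (Sub.ren f).get i = .var (f i)
  | _, _, _, .fz => rfl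
  | _, _, f, .fs i => Sub.get_ren (fun i => f (.fs i)) i

theorem Sub.get_comp : {l m n : ℕ} → (τ : Sub l m) → (σ : Sub m n) → (i : Fin2 l) →
    (τ.comp σ).get i = (τ.get i).sub σ
  | _, _, _, .snoc _ _, _, .fz => by simp [Sub.comp, Sub.get]
  | _, _, _, .snoc τ _, σ, .fs i => by simpa [Sub.comp, Sub.get] using Sub.get_comp τ σ i

theorem Sub.get_wk : {m n : ℕ} → (σ : Sub m n) → (i : Fin2 m) → σ.wk.get i = (σ.get i).wk
  | _, _, .snoc _ _, .fz => by simp [Sub.wk, Sub.get]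
  | _, _, .snoc σ _, .fs i => by simpa [Sub.wk, Sub.get] using Sub.get_wk σ i

mutual

theorem Ty.sub_wk : {m n : ℕ} → (A : Ty m) → (σ : Sub m n) → A.sub σ.wk = (A.sub σ).wk
  | _, _, .star, _ => by simp [Ty.sub, Ty.wk]
  | _, _, .arr s A t, σ => by
    simp [Ty.sub, Ty.wk, Tm.sub_wk s σ, Ty.sub_wk A σ, Tm.sub_wk t σ]

theorem Tm.sub_wk : {m n : ℕ} → (t : Tm m) → (σ : Sub m n) → t.sub σ.wk = (t.sub σ).wk
  | _, _, .var i, σ => by simp [Tm.sub, Sub.get_wk]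
  | _, _, .coh Δ A τ, σ => by simp [Tm.sub, Tm.wk, Sub.comp_wk τ σ]

theorem Sub.comp_wk : {l m n : ℕ} → (τ : Sub l m) → (σ : Sub m n) →
    τ.comp σ.wk = (τ.comp σ).wk
  | _, _, _, .nil, _ => by simp [Sub.comp, Sub.wk]
  | _, _, _, .snoc τ t, σ => by simp [Sub.comp, Sub.wk, Sub.comp_wk τ σ, Tm.sub_wk t σ]

end

mutual

theorem Ty.wk_sub : {m n : ℕ} → (A : Ty m) → (σ : Sub m n) → (u : Tm n) →
    A.wk.sub (σ.snoc u) = A.sub σ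
  | _, _, .star, _, _ => by simp [Ty.sub, Ty.wk]
  | _, _, .arr s A t, σ, u => by
    simp [Ty.sub, Ty.wk, Tm.wk_sub s σ, Ty.wk_sub A σ, Tm.wk_sub t σ]

theorem Tm.wk_sub : {m n : ℕ} → (t : Tm m) → (σ : Sub m n) → (u : Tm n) →
    t.wk.sub (σ.snoc u) = t.sub σ
  | _, _, .var i, σ, _ => by simp [Tm.sub, Tm.wk, Sub.get]
  | _, _, .coh Δ A τ, σ, u => by simp [Tm.sub, Tm.wk, Sub.wk_comp τ σ]

theorem Sub.wk_comp : {l m n : ℕ} → (τ : Sub l m) → (σ : Sub m n) → (u : Tm n) →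
    τ.wk.comp (σ.snoc u) = τ.comp σ
  | _, _, _, .nil, _, _ => by simp [Sub.comp, Sub.wk]
  | _, _, _, .snoc τ t, σ, u => by simp [Sub.comp, Sub.wk, Sub.wk_comp τ σ, Tm.wk_sub t σ]

end

mutual

theorem Ty.sub_sub : {l m n : ℕ} → (A : Ty l) → (τ : Sub l m) → (σ : Sub m n) →
    (A.sub τ).sub σ = A.sub (τ.comp σ)
  | _, _, _, .star, _, _ => by simp [Ty.sub]
  | _, _, _, .arr s A t, τ, σ => by
    simp [Ty.sub, Tm.sub_sub s τ σ, Ty.sub_sub A τ σ, Tm.sub_sub t τ σ]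

theorem Tm.sub_sub : {l m n : ℕ} → (t : Tm l) → (τ : Sub l m) → (σ : Sub m n) →
    (t.sub τ).sub σ = t.sub (τ.comp σ)
  | _, _, _, .var i, τ, σ => by simp [Tm.sub, Sub.get_comp]
  | _, _, _, .coh Δ A ρ, τ, σ => by simp [Tm.sub, Sub.comp_assoc ρ τ σ]

theorem Sub.comp_assoc : {k l m n : ℕ} → (ρ : Sub k l) → (τ : Sub l m) → (σ : Sub m n) →
    (ρ.comp τ).comp σ = ρ.comp (τ.comp σ)
  | _, _, _, _, .nil, _, _ => by simp [Sub.comp]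
  | _, _, _, _, .snoc ρ t, τ, σ => by
    simp [Sub.comp, Sub.comp_assoc ρ τ σ, Tm.sub_sub t τ σ]

end

mutual

theorem Ty.sub_id : {n : ℕ} → (A : Ty n) → A.sub (Sub.id n) = A
  | _, .star => by simp [Ty.sub]
  | _, .arr s A t => by simp [Ty.sub, Tm.sub_id s, Ty.sub_id A, Tm.sub_id t]

theorem Tm.sub_id : {n : ℕ} → (t : Tm n) → t.sub (Sub.id n) = t
  | _, .var i => by simp [Tm.sub, Sub.id, Sub.get_ren]
  | _, .coh Δ A τ => by simp [Tm.sub, Sub.comp_id τ]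

theorem Sub.comp_id : {m n : ℕ} → (σ : Sub m n) → σ.comp (Sub.id n) = σ
  | _, _, .nil => by simp [Sub.comp]
  | _, _, .snoc σ t => by simp [Sub.comp, Sub.comp_id σ, Tm.sub_id t]

end

theorem Sub.id_comp {m n : ℕ} (σ : Sub m n) : (Sub.id m).comp σ = σ :=
  Sub.ext_get _ _ fun i => by simp [Sub.get_comp, Sub.id, Sub.get_ren, Tm.sub]

theorem Sub.id_succ (n : ℕ) : Sub.id (n + 1) = (Sub.id n).wk.snoc (.var .fz) := by
  refine Sub.ext_get _ _ fun i => ?_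
  cases i with
  | fz => simp [Sub.id, Sub.get_ren, Sub.get]
  | fs i => simp [Sub.id, Sub.get_ren, Sub.get, Sub.get_wk, Tm.wk]

variable {R : RuleSet}

mutual

theorem EqTy.refl : {n : ℕ} → (Γ : Ctx n) → (A : Ty n) → EqTy R Γ A A
  | _, _, .star => .star
  | _, Γ, .arr s A t => .arr (EqTm.refl Γ s) (EqTm.refl Γ t) (EqTy.refl Γ A)

theorem EqTm.refl : {n : ℕ} → (Γ : Ctx n) → (t : Tm n) → EqTm R Γ t t
  | _, _, .var i => .var i
  | _, Γ, .coh Δ A σ => .coh (EqTy.refl Δ A) (EqSub.refl Γ σ)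

theorem EqSub.refl : {m n : ℕ} → (Γ : Ctx n) → (σ : Sub m n) → EqSub R Γ σ σ
  | _, _, _, .nil => .nil
  | _, _, Γ, .snoc σ t => .snoc (EqSub.refl Γ σ) (EqTm.refl Γ t)

end

theorem EqSub.symm : {m n : ℕ} → {Γ : Ctx n} → {σ τ : Sub m n} → EqSub R Γ σ τ → EqSub R Γ τ σ
  | _, _, _, .nil, .nil, _ => .nil
  | _, _, _, .snoc _ _, .snoc _ _, .snoc h h' => .snoc h.symm h'.symm

theorem EqSub.trans : {m n : ℕ} → {Γ : Ctx n} → {σ τ ρ : Sub m n} → EqSub R Γ σ τ →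
    EqSub R Γ τ ρ → EqSub R Γ σ ρ
  | _, _, _, .nil, .nil, .nil, _, _ => .nil
  | _, _, _, .snoc _ _, .snoc _ _, .snoc _ _, .snoc h h', .snoc k k' =>
    .snoc (h.trans k) (h'.trans k')

theorem EqSub.get : {m n : ℕ} → {Γ : Ctx n} → {σ τ : Sub m n} → EqSub R Γ σ τ → (i : Fin2 m) →
    EqTm R Γ (σ.get i) (τ.get i)
  | _, _, _, .snoc _ _, .snoc _ _, .snoc _ h', .fz => h'
  | _, _, _, .snoc _ _, .snoc _ _, .snoc h _, .fs i => h.get i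

mutual

theorem EqTy.congr : {m : ℕ} → (A : Ty m) → {n : ℕ} → {Γ : Ctx n} → {σ τ : Sub m n} →
    EqSub R Γ σ τ → EqTy R Γ (A.sub σ) (A.sub τ)
  | _, .star, _, _, _, _, _ => by simpa only [Ty.sub] using EqTy.star
  | _, .arr s A t, _, _, _, _, h => by
    simpa only [Ty.sub] using EqTy.arr (EqTm.congr s h) (EqTm.congr t h) (EqTy.congr A h)
termination_by structural _ A => A

theorem EqTm.congr : {m : ℕ} → (t : Tm m) → {n : ℕ} → {Γ : Ctx n} → {σ τ : Sub m n} →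
    EqSub R Γ σ τ → EqTm R Γ (t.sub σ) (t.sub τ)
  | _, .var i, _, _, _, _, h => by simpa only [Tm.sub] using h.get i
  | _, .coh Δ A ρ, _, _, _, _, h => by
    simpa only [Tm.sub] using EqTm.coh (EqTy.refl Δ A) (EqSub.congr ρ h)
termination_by structural _ t => t

theorem EqSub.congr : {l m : ℕ} → (ρ : Sub l m) → {n : ℕ} → {Γ : Ctx n} → {σ τ : Sub m n} →
    EqSub R Γ σ τ → EqSub R Γ (ρ.comp σ) (ρ.comp τ)
  | _, _, .nil, _, _, _, _, _ => by simpa only [Sub.comp] using EqSub.nil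
  | _, _, .snoc ρ t, _, _, _, _, h => by
    simpa only [Sub.comp] using EqSub.snoc (EqSub.congr ρ h) (EqTm.congr t h)
termination_by structural _ _ ρ => ρ

end

theorem WfSub.get_hasTy : {m n : ℕ} → {Γ : Ctx n} → {σ : Sub m n} → {Δ : Ctx m} →
    WfSub R Γ σ Δ → (i : Fin2 m) → HasTy R Γ (σ.get i) ((Δ.get i).sub σ)
  | _, _, _, .snoc _ _, .snoc _ _, .snoc _ _ h, .fz => by
    simpa only [Sub.get, Ctx.get, Ty.wk_sub] using h
  | _, _, _, .snoc _ _, .snoc _ _, .snoc h _ _, .fs i => by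
    simpa only [Sub.get, Ctx.get, Ty.wk_sub] using h.get_hasTy i

theorem HasTy.wk [R.Tame] {n : ℕ} {Γ : Ctx n} {t : Tm n} {A : Ty n} (h : HasTy R Γ t A) :
    ∀ B, WfTy R Γ B → HasTy R (Γ.snoc B) t.wk A.wk := by
  refine HasTy.rec (motive_1 := fun _ _ => True)
    (motive_2 := fun {n} Γ A _ => ∀ B, WfTy R Γ B → WfTy R (Γ.snoc B) A.wk)
    (motive_3 := fun {n} Γ t A _ => ∀ B, WfTy R Γ B → HasTy R (Γ.snoc B) t.wk A.wk)
    (motive_4 := fun {m n} Γ σ Δ _ => ∀ B, WfTy R Γ B → WfSub R (Γ.snoc B) σ.wk Δ)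
    (motive_5 := fun {n} Γ s t _ => ∀ B, WfTy R Γ B → EqTm R (Γ.snoc B) s.wk t.wk)
    (motive_6 := fun {n} Γ A A' _ => ∀ B, WfTy R Γ B → EqTy R (Γ.snoc B) A.wk A'.wk)
    (motive_7 := fun {m n} Γ σ τ _ => ∀ B, WfTy R Γ B → EqSub R (Γ.snoc B) σ.wk τ.wk)
    trivial (fun _ _ _ _ => trivial) ?_ ?_ ?_ ?_ ?_ ?_ ?_ ?_ ?_ ?_ ?_ ?_ ?_ ?_ ?_ ?_ ?_ h
  · intros; rw [Ty.wk]; exact .star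
  · intro _ _ _ _ _ _ _ _ hA hs ht B hB
    rw [Ty.wk]; exact .arr (hA B hB) (hs B hB) (ht B hB)
  · intro _ _ i hΓ _ B hB
    rw [Tm.wk]; exact HasTy.var (Fin2.fs i) (WfCtx.snoc hΓ hB)
  · intro _ _ T d _ _ _ _ hd hA _ h1 h2 _ hσ B hB
    simp only [Tm.wk, Ty.wk, ← Tm.sub_wk, ← Ty.sub_wk]
    exact HasTy.comp T d hd hA (hσ B hB) h1 h2
  · intro _ _ T _ _ _ _ hA _ h1 h2 _ hσ B hB
    simp only [Tm.wk, Ty.wk, ← Tm.sub_wk, ← Ty.sub_wk]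
    exact HasTy.full T hA (hσ B hB) h1 h2
  · intro _ _ _ _ _ _ _ h h' B hB
    exact .conv (h B hB) (h' B hB)
  · intros; rw [Sub.wk]; exact .nil
  · intro _ _ _ _ _ _ _ _ hA _ h _ ht B hB
    rw [Sub.wk]; exact .snoc (h B hB) hA (by rw [Ty.sub_wk]; exact ht B hB)
  · intro _ _ i B _
    exact EqTm.refl _ _
  · intro _ _ _ _ _ h B hB
    exact (h B hB).symm
  · intro _ _ _ _ _ _ _ h h' B hB
    exact (h B hB).trans (h' B hB)
  · intro _ _ _ _ _ _ _ _ hA _ _ h B hB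
    simp only [Tm.wk]; exact .coh hA (h B hB)
  · intro _ _ _ _ _ hr _ h B hB
    exact RuleSet.Tame.lifting _ _ hr (h B hB)
  · intros; rw [Ty.wk]; exact .star
  · intro _ _ _ _ _ _ _ _ _ _ _ h1 h2 h3 B hB
    simp only [Ty.wk]; exact .arr (h1 B hB) (h2 B hB) (h3 B hB)
  · intros; rw [Sub.wk]; exact .nil
  · intro _ _ _ _ _ _ _ _ _ h h' B hB
    simp only [Sub.wk]; exact .snoc (h B hB) (h' B hB)

theorem WfSub.wk [R.Tame] : {m n : ℕ} → {Γ : Ctx n} → {σ : Sub m n} → {Δ : Ctx m} →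
    WfSub R Γ σ Δ → ∀ B, WfTy R Γ B → WfSub R (Γ.snoc B) σ.wk Δ
  | _, _, _, .nil, .nil, _, _, _ => by rw [Sub.wk]; exact .nil
  | _, _, _, .snoc _ _, .snoc _ _, .snoc h hA ht, B, hB => by
    rw [Sub.wk]; exact .snoc (h.wk B hB) hA (by rw [Ty.sub_wk]; exact ht.wk B hB)

theorem HasTy.sub [R.Tame] {m : ℕ} {Γ : Ctx m} {t : Tm m} {A : Ty m} (h : HasTy R Γ t A) :
    ∀ {n} {Δ : Ctx n} {σ : Sub m n}, WfSub R Δ σ Γ → HasTy R Δ (t.sub σ) (A.sub σ) := by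
  refine HasTy.rec (motive_1 := fun _ _ => True)
    (motive_2 := fun {m} Γ A _ => ∀ {n} {Δ : Ctx n} {σ : Sub m n}, WfSub R Δ σ Γ →
      WfTy R Δ (A.sub σ))
    (motive_3 := fun {m} Γ t A _ => ∀ {n} {Δ : Ctx n} {σ : Sub m n}, WfSub R Δ σ Γ →
      HasTy R Δ (t.sub σ) (A.sub σ))
    (motive_4 := fun {l m} Γ τ Θ _ => ∀ {n} {Δ : Ctx n} {σ : Sub m n}, WfSub R Δ σ Γ →
      WfSub R Δ (τ.comp σ) Θ)
    (motive_5 := fun {m} Γ s t _ => ∀ {n} {Δ : Ctx n} {σ : Sub m n}, WfSub R Δ σ Γ →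
      EqTm R Δ (s.sub σ) (t.sub σ))
    (motive_6 := fun {m} Γ A B _ => ∀ {n} {Δ : Ctx n} {σ : Sub m n}, WfSub R Δ σ Γ →
      EqTy R Δ (A.sub σ) (B.sub σ))
    (motive_7 := fun {l m} Γ τ ρ _ => ∀ {n} {Δ : Ctx n} {σ : Sub m n}, WfSub R Δ σ Γ →
      EqSub R Δ (τ.comp σ) (ρ.comp σ))
    trivial (fun _ _ _ _ => trivial) ?_ ?_ ?_ ?_ ?_ ?_ ?_ ?_ ?_ ?_ ?_ ?_ ?_ ?_ ?_ ?_ ?_ h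
  · intros; rw [Ty.sub]; exact .star
  · intro _ _ _ _ _ _ _ _ hA hs ht _ _ _ hσ
    rw [Ty.sub]; exact .arr (hA hσ) (hs hσ) (ht hσ)
  · intro _ _ i hΓ _ _ _ _ hσ
    rw [Tm.sub]; exact hσ.get_hasTy i
  · intro _ _ T d _ _ _ _ hd hA _ h1 h2 _ hτ _ _ _ hσ
    simp only [Tm.sub, Ty.sub, Tm.sub_sub, Ty.sub_sub]
    exact HasTy.comp T d hd hA (hτ hσ) h1 h2
  · intro _ _ T _ _ _ _ hA _ h1 h2 _ hτ _ _ _ hσ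
    simp only [Tm.sub, Ty.sub, Tm.sub_sub, Ty.sub_sub]
    exact HasTy.full T hA (hτ hσ) h1 h2
  · intro _ _ _ _ _ _ _ h h' _ _ _ hσ
    exact .conv (h hσ) (h' hσ)
  · intros; rw [Sub.comp]; exact .nil
  · intro _ _ _ _ _ _ _ _ hA _ h _ ht _ _ _ hσ
    rw [Sub.comp]; exact .snoc (h hσ) hA (by rw [← Ty.sub_sub]; exact ht hσ)
  · intro _ _ i _ _ _ _
    exact EqTm.refl _ _
  · intro _ _ _ _ _ h _ _ _ hσ
    exact (h hσ).symm
  · intro _ _ _ _ _ _ _ h h' _ _ _ hσ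
    exact (h hσ).trans (h' hσ)
  · intro _ _ _ _ _ _ _ _ hA _ _ h _ _ _ hσ
    simp only [Tm.sub]; exact .coh hA (h hσ)
  · intro _ _ _ _ _ hr _ h _ _ _ hσ
    exact RuleSet.Tame.substitution _ _ hr hσ (h hσ)
  · intros; rw [Ty.sub]; exact .star
  · intro _ _ _ _ _ _ _ _ _ _ _ h1 h2 h3 _ _ _ hσ
    simp only [Ty.sub]; exact .arr (h1 hσ) (h2 hσ) (h3 hσ)
  · intros; rw [Sub.comp]; exact .nil
  · intro _ _ _ _ _ _ _ _ _ h h' _ _ _ hσ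
    simp only [Sub.comp]; exact .snoc (h hσ) (h' hσ)

theorem WfSub.comp [R.Tame] : {l m n : ℕ} → {Γ : Ctx m} → {Δ : Ctx n} → {σ : Sub m n} →
    {Θ : Ctx l} → {τ : Sub l m} → WfSub R Γ τ Θ → WfSub R Δ σ Γ → WfSub R Δ (τ.comp σ) Θ
  | _, _, _, _, _, _, .nil, .nil, _, _ => by rw [Sub.comp]; exact .nil
  | _, _, _, _, _, _, .snoc _ _, .snoc _ _, .snoc h hA ht, hσ => by
    rw [Sub.comp]; exact .snoc (h.comp hσ) hA (by rw [← Ty.sub_sub]; exact ht.sub hσ)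

theorem EqTm.sub [R.Tame] {m : ℕ} {Γ : Ctx m} {s t : Tm m} (h : EqTm R Γ s t) :
    ∀ {n} {Δ : Ctx n} {σ : Sub m n}, WfSub R Δ σ Γ → EqTm R Δ (s.sub σ) (t.sub σ) := by
  refine EqTm.rec (motive_1 := fun _ _ => True) (motive_2 := fun _ _ _ => True)
    (motive_3 := fun _ _ _ _ => True) (motive_4 := fun _ _ _ _ => True)
    (motive_5 := fun {m} Γ s t _ => ∀ {n} {Δ : Ctx n} {σ : Sub m n}, WfSub R Δ σ Γ →
      EqTm R Δ (s.sub σ) (t.sub σ))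
    (motive_6 := fun _ _ _ _ => True)
    (motive_7 := fun {l m} Γ τ ρ _ => ∀ {n} {Δ : Ctx n} {σ : Sub m n}, WfSub R Δ σ Γ →
      EqSub R Δ (τ.comp σ) (ρ.comp σ))
    ?_ ?_ ?_ ?_ ?_ ?_ ?_ ?_ ?_ ?_ ?_ ?_ ?_ ?_ ?_ ?_ ?_ ?_ ?_ h <;> try (intros; trivial)
  · intro _ _ i _ _ _ _
    exact EqTm.refl _ _
  · intro _ _ _ _ _ h _ _ _ hσ
    exact (h hσ).symm
  · intro _ _ _ _ _ _ _ h h' _ _ _ hσ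
    exact (h hσ).trans (h' hσ)
  · intro _ _ _ _ _ _ _ _ hA _ _ h _ _ _ hσ
    simp only [Tm.sub]; exact .coh hA (h hσ)
  · intro _ _ _ _ _ hr hs _ _ _ _ hσ
    exact RuleSet.Tame.substitution _ _ hr hσ (hs.sub hσ)
  · intros; rw [Sub.comp]; exact .nil
  · intro _ _ _ _ _ _ _ _ _ h h' _ _ _ hσ
    simp only [Sub.comp]; exact .snoc (h hσ) (h' hσ)

theorem EqSub.comp [R.Tame] : {l m n : ℕ} → {Γ : Ctx m} → {Δ : Ctx n} → {σ : Sub m n} →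
    {τ ρ : Sub l m} → EqSub R Γ τ ρ → WfSub R Δ σ Γ → EqSub R Δ (τ.comp σ) (ρ.comp σ)
  | _, _, _, _, _, _, .nil, .nil, _, _ => by rw [Sub.comp]; exact .nil
  | _, _, _, _, _, _, .snoc _ _, .snoc _ _, .snoc h h', hσ => by
    simp only [Sub.comp]; exact .snoc (h.comp hσ) (h'.sub hσ)

theorem WfSub.id [R.Tame] {n : ℕ} {Γ : Ctx n} (h : WfCtx R Γ) : WfSub R Γ (Sub.id n) Γ := by
  induction n with
  | zero => cases h; exact WfSub.nil
  | succ n ih =>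
    cases h with
    | snoc hΓ hA =>
      rw [Sub.id_succ]
      refine WfSub.snoc ((ih hΓ).wk _ hA) hA ?_
      rw [Ty.sub_wk, Ty.sub_id]
      exact HasTy.var Fin2.fz (WfCtx.snoc hΓ hA)

/-- The objects of Catt_R: the well-typed contexts. -/
structure Obj (R : RuleSet) : Type where
  len : ℕ
  ctx : Ctx len
  wf : WfCtx R ctx

/-- The well-typed substitutions from `Δ` to `Γ`. -/
def Obj.WSub (Δ Γ : Obj R) : Type := {σ : Sub Δ.len Γ.len // WfSub R Γ.ctx σ Δ.ctx}

/-- Definitional equality of substitutions. -/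
instance Obj.setoid (Δ Γ : Obj R) : Setoid (Δ.WSub Γ) where
  r σ τ := EqSub R Γ.ctx σ.1 τ.1
  iseqv := ⟨fun _ => EqSub.refl _ _, EqSub.symm, EqSub.trans⟩

/-- The category Catt_R of well-typed contexts, and of well-typed substitutions up to definitional
equality. The composite of `τ : Θ → Δ` and `σ : Δ → Γ` is `τ ≫ σ`. -/
instance Obj.category [R.Tame] : CategoryTheory.Category (Obj R) where
  Hom Δ Γ := Quotient (Obj.setoid Δ Γ)
  id Γ := Quotient.mk _ ⟨Sub.id Γ.len, WfSub.id Γ.wf⟩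
  comp {Θ Δ Γ} := Quotient.map₂ (fun τ σ => ⟨τ.1.comp σ.1, WfSub.comp τ.2 σ.2⟩)
    fun _ τ' hτ σ _ hσ => EqSub.trans (EqSub.comp hτ σ.2) (EqSub.congr τ'.1 hσ)
  id_comp := by
    rintro Δ Γ ⟨σ⟩
    exact congrArg (Quotient.mk _) (Subtype.ext (Sub.id_comp σ.1))
  comp_id := by
    rintro Δ Γ ⟨σ⟩
    exact congrArg (Quotient.mk _) (Subtype.ext (Sub.comp_id σ.1))
  assoc := by
    rintro _ _ _ _ ⟨ρ⟩ ⟨τ⟩ ⟨σ⟩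
    exact congrArg (Quotient.mk _) (Subtype.ext (Sub.comp_assoc ρ.1 τ.1 σ.1))

/-- The morphism of Catt_R given by a well-typed substitution. -/
def Obj.hom [R.Tame] {Δ Γ : Obj R} (σ : Sub Δ.len Γ.len) (h : WfSub R Γ.ctx σ Δ.ctx) : Δ ⟶ Γ :=
  Quotient.mk (Obj.setoid Δ Γ) ⟨σ, h⟩

/-! ## Discs and unbiased coherences -/

/-- The context with variables `d_k⁻, d_k⁺` for `k < n`, together with the type of the cells that
it bounds. -/
def sphere : (n : ℕ) → Ctx (2 * n) × Ty (2 * n)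
  | 0 => (.nil, .star)
  | n + 1 =>
    (((sphere n).1.snoc (sphere n).2).snoc (sphere n).2.wk,
      .arr (.var (.fs .fz)) (sphere n).2.wk.wk (.var .fz))

/-- The disc context `Dⁿ`. -/
def disc (n : ℕ) : Ctx (2 * n + 1) := (sphere n).1.snoc (sphere n).2

/-- The sources and targets occurring in a type. -/
def Ty.toSub : {k : ℕ} → (A : Ty k) → Sub (2 * A.dim) k
  | _, .star => .nil
  | _, .arr s A t => (A.toSub.snoc s).snoc t

/-- The substitution `{A, t} : D^{dim A} → Γ`. -/
def discSub {k : ℕ} (A : Ty k) (t : Tm k) : Sub (2 * A.dim + 1) k := A.toSub.snoc t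

namespace Tree

/-- The unbiased coherence over a tree, given its unbiased type. -/
def cohOf (T : Tree) (U : Ty (T.size + 1)) : Tm (T.size + 1) := .coh T.ctx U (Sub.id _)

/-- The unbiased type `𝒰_T^n`. The unbiased term `𝒯_B^n` over `B = ∂_n T` is the last variable
`d_n` of `B` if `B` is `Dⁿ`, and `𝒞_B^n` otherwise. -/
def unbTy : (n : ℕ) → (T : Tree) → Ty (T.size + 1)
  | 0, _ => .star
  | n + 1, T =>
    let t : Tm ((bdry n T).size + 1) :=
      if (bdry n T).IsLinear ∧ (bdry n T).dim = n then .var .fz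
      else (bdry n T).cohOf (unbTy n (bdry n T))
    .arr (t.sub (inc false n T)) (unbTy n T) (t.sub (inc true n T))

/-- The unbiased coherence `𝒞_T^n`. -/
def unbCoh (n : ℕ) (T : Tree) : Tm (T.size + 1) := T.cohOf (unbTy n T)

theorem dim_unbTy : (n : ℕ) → (T : Tree) → (unbTy n T).dim = n
  | 0, _ => rfl
  | n + 1, T => congrArg (· + 1) (dim_unbTy n T)

/-- The substitution `{𝒰_T^n, 𝒞_T^n} : Dⁿ → T`. -/
def unbSub (n : ℕ) (T : Tree) : Sub (2 * n + 1) (T.size + 1) :=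
  (discSub (unbTy n T) (unbCoh n T)).cast (by rw [dim_unbTy])

theorem IsLinear.size_eq : {T : Tree} → T.IsLinear → T.size = 2 * T.dim
  | nil, _ => rfl
  | cons T nil, h => by
    have h' : T.IsLinear := by simpa [IsLinear, th, dim] using h
    simp [size, dim, IsLinear.size_eq h']; omega
  | cons T (cons T' Ts), h => by simp [IsLinear, th, dim] at h; omega

end Tree

/-! ## Insertion -/

open Catt.Tree

/-- The branches of a tree, i.e. the nonempty lists of natural numbers indexing a linear subtree:
for `S = cons S₀ Ss`, `here` is the list `[0]`, `down P` is `0 :: P`, and `right P` is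
`(k + 1) :: P'` where `P = k :: P'`. -/
inductive Branch : Tree → Type
  | here {S₀ Ss : Tree} : S₀.IsLinear → Branch (cons S₀ Ss)
  | down {S₀ Ss : Tree} : Branch S₀ → Branch (cons S₀ Ss)
  | right {S₀ Ss : Tree} : Branch Ss → Branch (cons S₀ Ss)

namespace Branch

/-- Branch height: one less than the length of the branch as a list. -/
def bh : {S : Tree} → Branch S → ℕ
  | _, here _ => 0
  | _, down P => P.bh + 1
  | _, right P => P.bh

/-- The locally maximal variable `⌊P⌋`. -/
def var : {S : Tree} → Branch S → Fin2 (S.size + 1)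
  | cons S₀ Ss, here _ => wedgeL (a := S₀.size + 2) Ss.size .fz
  | cons S₀ Ss, down P => wedgeL (a := S₀.size + 2) Ss.size (suspVar P.var)
  | cons S₀ Ss, right P => wedgeR (a := S₀.size + 2) (southVar (S₀.size + 1)) Ss.size P.var

/-- The type of `⌊P⌋`. -/
def ty {S : Tree} (P : Branch S) : Ty (S.size + 1) := S.ctx.get P.var

/-- Leaf height: the dimension of `⌊P⌋`. -/
def lh {S : Tree} (P : Branch S) : ℕ := P.ty.dim

end Branch

/-- The inclusion of `T` in `T ++ Ss`. -/
def appL : (T Ss : Tree) → Sub (T.size + 1) ((T.append Ss).size + 1)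
  | nil, Ss => .snoc .nil (.var (firstVar Ss.size))
  | cons T Ts, Ss =>
    Sub.wedge (a := T.size + 2) (a' := T.size + 2) (Sub.id _) (southVar (T.size + 1)) (appL Ts Ss)

/-- The inclusion of `Ss` in `T ++ Ss`. -/
def appR : (T Ss : Tree) → Sub (Ss.size + 1) ((T.append Ss).size + 1)
  | nil, _ => Sub.id _
  | cons T Ts, Ss =>
    (appR Ts Ss).comp
      (Sub.ren (wedgeR (a := T.size + 2) (southVar (T.size + 1)) (Ts.append Ss).size))

/-- The inserted tree. -/
def insert : {S : Tree} → (P : Branch S) → (T : Tree) → P.bh ≤ T.th → Tree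
  | cons _ Ss, .here _, T, _ => T.append Ss
  | cons _ Ss, .down P, cons T nil, h => cons (insert P T (Nat.le_of_succ_le_succ h)) Ss
  | cons _ _, .down _, nil, h => absurd h (Nat.not_succ_le_zero _)
  | cons _ _, .down _, cons _ (cons _ _), h => absurd h (Nat.not_succ_le_zero _)
  | cons S₀ _, .right P, T, h => cons S₀ (insert P T h)

/-- The interior substitution `ι`. -/
def interior : {S : Tree} → (P : Branch S) → (T : Tree) → (h : P.bh ≤ T.th) →
    Sub (T.size + 1) ((insert P T h).size + 1)
  | cons _ Ss, .here _, T, _ => appL T Ss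
  | cons _ Ss, .down P, cons T nil, h =>
    (interior P T (Nat.le_of_succ_le_succ h)).susp.comp (Sub.ren (wedgeL Ss.size))
  | cons _ _, .down _, nil, h => absurd h (Nat.not_succ_le_zero _)
  | cons _ _, .down _, cons _ (cons _ _), h => absurd h (Nat.not_succ_le_zero _)
  | cons S₀ _, .right P, T, h =>
    (interior P T h).comp (Sub.ren (wedgeR (a := S₀.size + 2) (southVar (S₀.size + 1)) _))

/-- The exterior substitution `κ`. In the first case `Σ⌊S₀⌋` is the disc of dimension
`dim S₀ + 1`. -/
def exterior : {S : Tree} → (P : Branch S) → (T : Tree) → (h : P.bh ≤ T.th) →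
    Sub (S.size + 1) ((insert P T h).size + 1)
  | cons S₀ Ss, .here hS, T, _ =>
    Sub.copair (a := S₀.size + 2)
      (((unbSub (S₀.dim + 1) T).cast (by rw [hS.size_eq]; omega)).comp (appL T Ss))
      Ss.size (appR T Ss)
  | cons S₀ Ss, .down P, cons T nil, h =>
    Sub.wedge (a := S₀.size + 2) (exterior P T (Nat.le_of_succ_le_succ h)).susp
      (southVar _) (Sub.id (Ss.size + 1))
  | cons _ _, .down _, nil, h => absurd h (Nat.not_succ_le_zero _)
  | cons _ _, .down _, cons _ (cons _ _), h => absurd h (Nat.not_succ_le_zero _)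
  | cons S₀ _, .right P, T, h =>
    Sub.wedge (a := S₀.size + 2) (a' := S₀.size + 2) (Sub.id _) (southVar (S₀.size + 1))
      (exterior P T h)

/-! ### Labellings and the inserted substitution -/

/-- A labelling `t₀ L₁ t₁ ⋯ Lₙ tₙ` of a tree by terms: `nil t` is the labelling `t` of the empty
tree, and `cons t L Ls` is the labelling `Ls` preceded by `t L`. -/
inductive Label (k : ℕ) : Tree → Type
  | nil : Tm k → Label k .nil
  | cons {T Ts : Tree} : Tm k → Label k T → Label k Ts → Label k (.cons T Ts)

namespace Label

/-- The first term `t₀` of a labelling. -/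
def first {k : ℕ} : {T : Tree} → Label k T → Tm k
  | _, nil t => t
  | _, cons t _ _ => t

/-- The labelling with its first term replaced by `t`. -/
def setFirst {k : ℕ} (t : Tm k) : {T : Tree} → Label k T → Label k T
  | _, nil _ => nil t
  | _, cons _ L Ls => cons t L Ls

/-- Concatenation of labellings, keeping the last term of the first one and dropping the first term
of the second one. -/
def append {k : ℕ} : {T Ss : Tree} → Label k T → Label k Ss → Label k (T.append Ss)
  | _, _, nil t, Ls => Ls.setFirst t
  | _, _, cons t M Ms, Ls => cons t M (Ms.append Ls)

/-- The substitution out of a suspended context sending `N` to `s`, `S` to `t`, and the other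
variables as `σ` does. -/
def unsusp {k : ℕ} (s t : Tm k) : {m : ℕ} → Sub m k → Sub (m + 2) k
  | _, .nil => .snoc (.snoc .nil s) t
  | _, .snoc σ u => .snoc (unsusp s t σ) u

/-- The substitution corresponding to a labelling. -/
def toSub {k : ℕ} : {T : Tree} → Label k T → Sub (T.size + 1) k
  | _, nil t => .snoc .nil t
  | .cons T Ts, cons t L Ls =>
    Sub.copair (a := T.size + 2) (unsusp t Ls.first L.toSub) Ts.size Ls.toSub

/-- The labelling corresponding to a substitution. -/
def ofSub {k : ℕ} : (T : Tree) → Sub (T.size + 1) k → Label k T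
  | .nil, σ => nil (σ.get .fz)
  | .cons T Ts, σ =>
    cons (σ.get (firstVar _))
      (ofSub T ((Sub.ren fun i => wedgeL (a := T.size + 2) Ts.size (suspVar i)).comp σ))
      (ofSub Ts ((Sub.ren (wedgeR (a := T.size + 2) (southVar (T.size + 1)) Ts.size)).comp σ))

/-- The inserted labelling. -/
def insert {k : ℕ} : {S : Tree} → (P : Branch S) → (T : Tree) → (h : P.bh ≤ T.th) →
    Label k S → Label k T → Label k (Catt.insert P T h)
  | .cons _ _, .here _, _, _, cons _ _ Ls, M => M.append Ls
  | .cons _ _, .down P, .cons T .nil, h, cons _ L Ls, cons t₀ M (nil t₁) =>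
    cons t₀ (insert P T (Nat.le_of_succ_le_succ h) L M) (Ls.setFirst t₁)
  | .cons _ _, .down _, .nil, h, _, _ => absurd h (Nat.not_succ_le_zero _)
  | .cons _ _, .down _, .cons _ (.cons _ _), h, _, _ => absurd h (Nat.not_succ_le_zero _)
  | .cons _ _, .right P, T, h, cons s L Ls, M => cons s L (insert P T h Ls M)

end Label

/-- The inserted substitution. -/
def insertSub {k : ℕ} {S : Tree} (P : Branch S) (T : Tree) (h : P.bh ≤ T.th)
    (σ : Sub (S.size + 1) k) (τ : Sub (T.size + 1) k) : Sub ((insert P T h).size + 1) k :=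
  (Label.insert P T h (Label.ofSub S σ) (Label.ofSub T τ)).toSub

end Catt

open CategoryTheory

/-!
The contexts of trees are globular: their types are built from variables only. All maps between
them that occur here, apart from `{𝒰_T^n, 𝒞_T^n}` and the exterior substitution `κ`, are
type-preserving renamings (`Sub.IsIncl`), so that their typing is a syntactic matter.

The unbiased types and coherences are well-typed (`Tree.unbTy_wf`, `Tree.unbCoh_hasTy_of`): the
inclusions of boundaries satisfy the globularity relations (`Tree.inc_comp_inc`), whence
`𝒰_{∂_k T}^j[inc_k^±] = 𝒰_T^j` for `j ≤ k` (`Tree.unbTy_bdry_sub_inc`), and the unbiased terms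
have full support (`Tree.supp_unbTm`), so that their images under the inclusions have exactly the
supports that the typing rules for coherences ask for.

A recursion on the branch `P` shows the following about an insertion (`InsertSpec`, `insertSpec`),
all of it up to syntactic equality. The square commutes. The substitution `ι` is a type-preserving
renaming along which the inserted substitution `σ ≫_P τ` restricts to `τ`. Every variable of `S`
either lies in the disc of `P`, or is outer: `κ` sends it to a variable of the corresponding type,
at which `σ ≫_P τ` takes the value of `σ`. Finally every variable of the inserted tree comes from
`T` or from an outer variable of `S`. In the recursion, going down a branch suspends the whole
square, which uses that `𝒰_{ΣT}^{n+1} = Σ𝒰_T^n` and `𝒞_{ΣT}^{n+1} = Σ𝒞_T^n`.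

Given a cocone `(σ, τ)`, the composite of `κ` with `σ ≫_P τ` equals `σ` syntactically at outer
variables, and up to definitional equality on the disc by commutativity of the square and the
cocone condition. Together with the conversion rule this shows that `σ ≫_P τ` is well-typed,
variable by variable, and it yields existence in the universal property. Uniqueness holds because
`κ` and `ι` together reach every variable of the inserted tree. That syntactic equality of `P[σ]`
and `𝒞_T^n[τ]` already gives a cocone is uniqueness of types up to definitional equality
(`HasTy.eqTy`).
-/

namespace Catt

open Catt.Tree

variable {R : RuleSet}

/-! ### Suspension commutes with weakening and substitution -/

theorem suspVar_cases : {n : ℕ} → (i : Fin2 (n + 2)) →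
    i = northVar n ∨ i = southVar n ∨ ∃ j, i = suspVar j
  | 0, .fz => .inr (.inl rfl)
  | 0, .fs .fz => .inl rfl
  | _ + 1, .fz => .inr (.inr ⟨.fz, rfl⟩)
  | n + 1, .fs i => by
    rcases suspVar_cases (n := n) i with rfl | rfl | ⟨j, rfl⟩
    · exact .inl rfl
    · exact .inr (.inl rfl)
    · exact .inr (.inr ⟨.fs j, rfl⟩)

theorem firstVar_eq_northVar : (n : ℕ) → firstVar (n + 1) = northVar n
  | 0 => rfl
  | n + 1 => congrArg Fin2.fs (firstVar_eq_northVar n)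

theorem Sub.susp_get_north : {m n : ℕ} → (σ : Sub m n) →
    σ.susp.get (northVar m) = .var (northVar n)
  | _, _, .nil => rfl
  | _, _, .snoc σ _ => Sub.susp_get_north σ

theorem Sub.susp_get_south : {m n : ℕ} → (σ : Sub m n) →
    σ.susp.get (southVar m) = .var (southVar n)
  | _, _, .nil => rfl
  | _, _, .snoc σ _ => Sub.susp_get_south σ

theorem Sub.susp_get : {m n : ℕ} → (σ : Sub m n) → (i : Fin2 m) →
    σ.susp.get (suspVar i) = (σ.get i).susp
  | _, _, .snoc _ _, .fz => rfl
  | _, _, .snoc σ _, .fs i => Sub.susp_get σ i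

mutual

theorem Ty.susp_wk : {n : ℕ} → (A : Ty n) → A.wk.susp = A.susp.wk
  | _, .star => rfl
  | _, .arr s A t => by
    simp only [Ty.wk, Ty.susp, Tm.susp_wk s, Ty.susp_wk A, Tm.susp_wk t]

theorem Tm.susp_wk : {n : ℕ} → (t : Tm n) → t.wk.susp = t.susp.wk
  | _, .var i => rfl
  | _, .coh Δ A σ => by simp only [Tm.wk, Tm.susp, Sub.susp_wk σ]

theorem Sub.susp_wk : {m n : ℕ} → (σ : Sub m n) → σ.wk.susp = σ.susp.wk
  | _, _, .nil => rfl
  | _, _, .snoc σ t => by simp only [Sub.wk, Sub.susp, Sub.susp_wk σ, Tm.susp_wk t]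

end

mutual

theorem Ty.susp_sub : {m n : ℕ} → (A : Ty m) → (σ : Sub m n) →
    (A.sub σ).susp = A.susp.sub σ.susp
  | _, _, .star, σ => by
    simp only [Ty.sub, Ty.susp, Tm.sub, Sub.susp_get_north, Sub.susp_get_south]
  | _, _, .arr s A t, σ => by
    simp only [Ty.sub, Ty.susp, Tm.susp_sub s, Ty.susp_sub A, Tm.susp_sub t]

theorem Tm.susp_sub : {m n : ℕ} → (t : Tm m) → (σ : Sub m n) →
    (t.sub σ).susp = t.susp.sub σ.susp
  | _, _, .var i, σ => by simp only [Tm.sub, Tm.susp, Sub.susp_get]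
  | _, _, .coh Δ A τ, σ => by simp only [Tm.sub, Tm.susp, Sub.susp_comp τ]

theorem Sub.susp_comp : {l m n : ℕ} → (τ : Sub l m) → (σ : Sub m n) →
    (τ.comp σ).susp = τ.susp.comp σ.susp
  | _, _, _, .nil, σ => by
    simp only [Sub.comp, Sub.susp, Tm.sub, Sub.susp_get_north, Sub.susp_get_south]
  | _, _, _, .snoc τ t, σ => by
    simp only [Sub.comp, Sub.susp, Sub.susp_comp τ, Tm.susp_sub t]

end

/-- Substitutions out of a suspended context are determined by their values at `N`, at `S`, and at
the copies of the original variables. -/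
theorem Sub.ext_susp {m n : ℕ} {σ τ : Sub (m + 2) n}
    (hN : σ.get (northVar m) = τ.get (northVar m)) (hS : σ.get (southVar m) = τ.get (southVar m))
    (h : ∀ i, σ.get (suspVar i) = τ.get (suspVar i)) : σ = τ := by
  refine Sub.ext_get _ _ fun i => ?_
  rcases suspVar_cases i with rfl | rfl | ⟨j, rfl⟩
  exacts [hN, hS, h j]

theorem Sub.get_id {n : ℕ} (i : Fin2 n) : (Sub.id n).get i = .var i := Sub.get_ren _ i

theorem Sub.susp_id (n : ℕ) : (Sub.id n).susp = Sub.id (n + 2) := by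
  apply Sub.ext_susp <;>
  simp [Sub.susp_get_north, Sub.susp_get_south, Sub.susp_get, Sub.get_id, Tm.susp]

theorem Ctx.susp_get_north : {n : ℕ} → (Γ : Ctx n) → Γ.susp.get (northVar n) = .star
  | _, .nil => rfl
  | _, .snoc Γ _ => by
    simp only [Ctx.susp, northVar, Ctx.get]
    rw [Ctx.susp_get_north Γ]; rfl

theorem Ctx.susp_get_south : {n : ℕ} → (Γ : Ctx n) → Γ.susp.get (southVar n) = .star
  | _, .nil => rfl
  | _, .snoc Γ _ => by
    simp only [Ctx.susp, southVar, Ctx.get]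
    rw [Ctx.susp_get_south Γ]; rfl

theorem Ctx.susp_get : {n : ℕ} → (Γ : Ctx n) → (i : Fin2 n) →
    Γ.susp.get (suspVar i) = (Γ.get i).susp
  | _, .snoc _ A, .fz => (Ty.susp_wk A).symm
  | _, .snoc Γ _, .fs i => by
    simp only [Ctx.susp, suspVar, Ctx.get, Ctx.susp_get Γ i, Ty.susp_wk]

theorem Ty.dim_susp : {n : ℕ} → (A : Ty n) → A.susp.dim = A.dim + 1
  | _, .star => rfl
  | _, .arr _ A _ => congrArg (· + 1) (Ty.dim_susp A)

theorem Ty.dim_sub : {m n : ℕ} → (A : Ty m) → (σ : Sub m n) → (A.sub σ).dim = A.dim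
  | _, _, .star, _ => by simp only [Ty.sub, Ty.dim]
  | _, _, .arr _ A _, σ => by
    simp only [Ty.sub, Ty.dim, Ty.dim_sub A σ]

/-! ### Variables and types of a wedge sum -/

theorem wedge_cases {a : ℕ} (x : Fin2 (a + 1)) : (b : ℕ) → (i : Fin2 (a + b + 1)) →
    (∃ j, i = wedgeL b j) ∨ ∃ j, i = wedgeR x b j
  | 0, i => .inl ⟨i, rfl⟩
  | _ + 1, .fz => .inr ⟨.fz, rfl⟩
  | b + 1, .fs i => by
    rcases wedge_cases x b i with ⟨j, rfl⟩ | ⟨j, rfl⟩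
    · exact .inl ⟨j, rfl⟩
    · exact .inr ⟨.fs j, rfl⟩

theorem wedgeR_first {a : ℕ} (x : Fin2 (a + 1)) : (b : ℕ) → wedgeR x b (firstVar b) = wedgeL b x
  | 0 => rfl
  | b + 1 => congrArg Fin2.fs (wedgeR_first x b)

theorem wedgeL_first {a : ℕ} : (b : ℕ) → wedgeL b (firstVar a) = firstVar (a + b)
  | 0 => rfl
  | b + 1 => congrArg Fin2.fs (wedgeL_first b)

theorem Sub.copair_wedgeL {a k : ℕ} (σ : Sub (a + 1) k) : (b : ℕ) → (τ : Sub (b + 1) k) →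
    (i : Fin2 (a + 1)) → (σ.copair b τ).get (wedgeL b i) = σ.get i
  | 0, _, _ => rfl
  | b + 1, .snoc τ _, i => Sub.copair_wedgeL σ b τ i

theorem Sub.copair_wedgeR {a k : ℕ} (σ : Sub (a + 1) k) (x : Fin2 (a + 1)) : (b : ℕ) →
    (τ : Sub (b + 1) k) → τ.get (firstVar b) = σ.get x → (i : Fin2 (b + 1)) →
    (σ.copair b τ).get (wedgeR x b i) = τ.get i
  | 0, _, h, .fz => h.symm
  | _ + 1, .snoc _ _, _, .fz => rfl
  | b + 1, .snoc τ _, h, .fs i => Sub.copair_wedgeR σ x b τ h i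

theorem Ctx.wedge_get_wedgeL {a : ℕ} (Γ : Ctx (a + 1)) (x : Fin2 (a + 1)) : (b : ℕ) →
    (Δ : Ctx (b + 1)) → (i : Fin2 (a + 1)) →
    (Γ.wedge x b Δ).get (wedgeL b i) = (Γ.get i).sub (Sub.ren (wedgeL b))
  | 0, _, i => ((Γ.get i).sub_id).symm
  | b + 1, .snoc Δ A, i => by
    have h : (Sub.ren (wedgeL (a := a) (b + 1))) = (Sub.ren (wedgeL b)).wk :=
      Sub.ext_get _ _ fun i => by simp [Sub.get_ren, Sub.get_wk, wedgeL, Tm.wk]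
    rw [h, Ty.sub_wk, ← Ctx.wedge_get_wedgeL Γ x b Δ i]; rfl

theorem ren_wedgeR_succ {a : ℕ} (x : Fin2 (a + 1)) (b : ℕ) :
    Sub.ren (wedgeR x (b + 1)) = (Sub.ren (wedgeR x b)).wk.snoc (.var .fz) := by
  refine Sub.ext_get _ _ fun i => ?_
  cases i with
  | fz => rfl
  | fs i =>
    change _ = (Sub.ren (wedgeR x b)).wk.get i
    rw [Sub.get_ren, Sub.get_wk, Sub.get_ren]; rfl

theorem Ty.eq_star_of_wk : {n : ℕ} → {A : Ty n} → A.wk = .star → A = .star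
  | _, .star, _ => rfl
  | _, .arr _ _ _, h => by simp [Ty.wk] at h

theorem Ctx.wedge_get_wedgeR {a : ℕ} (Γ : Ctx (a + 1)) (x : Fin2 (a + 1))
    (hx : Γ.get x = .star) : (b : ℕ) → (Δ : Ctx (b + 1)) → Δ.get (firstVar b) = .star →
    (i : Fin2 (b + 1)) →
    (Γ.wedge x b Δ).get (wedgeR x b i) = (Δ.get i).sub (Sub.ren (wedgeR x b))
  | 0, _, h, .fz => by
    simp only [firstVar] at h
    rw [h, Ty.sub]; exact hx
  | b + 1, .snoc Δ A, h, .fz => by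
    rw [ren_wedgeR_succ]
    simp only [Ctx.get, Ctx.wedge, wedgeR, Ty.wk_sub, Ty.sub_wk]
  | b + 1, .snoc Δ A, h, .fs i => by
    rw [ren_wedgeR_succ]
    simp only [Ctx.get, Ctx.wedge, wedgeR, Ty.wk_sub, Ty.sub_wk]
    rw [Ctx.wedge_get_wedgeR Γ x hx b Δ (Ty.eq_star_of_wk h) i]

namespace Tree

/-! ### Variables of the context of a tree -/

/-- The variable of `Σ⌊T⌋ ∨ ⌊Ts⌋` coming from a variable of `Σ⌊T⌋`. -/
def sus {T : Tree} (Ts : Tree) (i : Fin2 (T.size + 2 + 1)) : Fin2 ((cons T Ts).size + 1) :=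
  wedgeL (a := T.size + 2) Ts.size i

/-- The variable of `Σ⌊T⌋ ∨ ⌊Ts⌋` coming from a variable of `⌊T⌋`. -/
def inn {T : Tree} (Ts : Tree) (i : Fin2 (T.size + 1)) : Fin2 ((cons T Ts).size + 1) :=
  sus Ts (suspVar i)

/-- The variable of `Σ⌊T⌋ ∨ ⌊Ts⌋` coming from a variable of `⌊Ts⌋`. -/
def rst (T : Tree) {Ts : Tree} (i : Fin2 (Ts.size + 1)) : Fin2 ((cons T Ts).size + 1) :=
  wedgeR (a := T.size + 2) (southVar (T.size + 1)) Ts.size i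

/-- The substitution out of `Σ⌊T⌋ ∨ ⌊Ts⌋` that is `σ` on `Σ⌊T⌋` and `τ` on the variables of `⌊Ts⌋`
other than the first one. -/
def pair {T Ts : Tree} {k : ℕ} (σ : Sub (T.size + 2 + 1) k) (τ : Sub (Ts.size + 1) k) :
    Sub ((cons T Ts).size + 1) k :=
  Sub.copair (a := T.size + 2) σ Ts.size τ

theorem sus_north (T Ts : Tree) :
    sus Ts (northVar (T.size + 1)) = firstVar (cons T Ts).size := by
  rw [← firstVar_eq_northVar]; exact wedgeL_first (a := T.size + 2) Ts.size

theorem sus_south (T Ts : Tree) :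
    sus Ts (southVar (T.size + 1)) = rst T (firstVar Ts.size) :=
  (wedgeR_first _ _).symm

theorem sus_or_rst {T Ts : Tree} (i : Fin2 ((cons T Ts).size + 1)) :
    (∃ j, i = sus Ts j) ∨ ∃ j, i = rst T j :=
  wedge_cases (a := T.size + 2) (southVar (T.size + 1)) Ts.size i

theorem cons_cases {T Ts : Tree} (i : Fin2 ((cons T Ts).size + 1)) :
    i = firstVar _ ∨ (∃ j, i = inn Ts j) ∨ ∃ j, i = rst T j := by
  rcases sus_or_rst i with ⟨j, rfl⟩ | ⟨j, rfl⟩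
  · rcases suspVar_cases j with rfl | rfl | ⟨j, rfl⟩
    · exact .inl (sus_north T Ts)
    · exact .inr (.inr ⟨_, sus_south T Ts⟩)
    · exact .inr (.inl ⟨j, rfl⟩)
  · exact .inr (.inr ⟨j, rfl⟩)

theorem pair_sus {T Ts : Tree} {k : ℕ} (σ : Sub (T.size + 2 + 1) k) (τ : Sub (Ts.size + 1) k)
    (i : Fin2 (T.size + 2 + 1)) : (pair σ τ).get (sus Ts i) = σ.get i :=
  Sub.copair_wedgeL (a := T.size + 2) _ _ _ _

theorem pair_first {T Ts : Tree} {k : ℕ} (σ : Sub (T.size + 2 + 1) k) (τ : Sub (Ts.size + 1) k) :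
    (pair σ τ).get (firstVar _) = σ.get (northVar (T.size + 1)) := by
  rw [← sus_north, pair_sus]

theorem pair_rst {T Ts : Tree} {k : ℕ} {σ : Sub (T.size + 2 + 1) k} {τ : Sub (Ts.size + 1) k}
    (h : τ.get (firstVar Ts.size) = σ.get (southVar (T.size + 1))) (i : Fin2 (Ts.size + 1)) :
    (pair σ τ).get (rst T i) = τ.get i :=
  Sub.copair_wedgeR (a := T.size + 2) _ _ _ _ h _

theorem ren_sus_comp_pair {T Ts : Tree} {k : ℕ} (σ : Sub (T.size + 2 + 1) k)
    (τ : Sub (Ts.size + 1) k) : (Sub.ren (sus Ts)).comp (pair σ τ) = σ :=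
  Sub.ext_get _ _ fun i => by rw [Sub.get_comp, Sub.get_ren, Tm.sub, pair_sus]

theorem ren_rst_comp_pair {T Ts : Tree} {k : ℕ} {σ : Sub (T.size + 2 + 1) k}
    {τ : Sub (Ts.size + 1) k} (h : τ.get (firstVar Ts.size) = σ.get (southVar (T.size + 1))) :
    (Sub.ren (rst T)).comp (pair σ τ) = τ :=
  Sub.ext_get _ _ fun i => by rw [Sub.get_comp, Sub.get_ren, Tm.sub, pair_rst h]

theorem ext_cons {T Ts : Tree} {k : ℕ} {σ τ : Sub ((cons T Ts).size + 1) k}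
    (hs : (Sub.ren (sus Ts)).comp σ = (Sub.ren (sus Ts)).comp τ)
    (hr : (Sub.ren (rst T)).comp σ = (Sub.ren (rst T)).comp τ) : σ = τ := by
  refine Sub.ext_get _ _ fun i => ?_
  rcases sus_or_rst i with ⟨j, rfl⟩ | ⟨j, rfl⟩
  · simpa [Sub.get_comp, Sub.get_ren, Tm.sub] using congrArg (Sub.get · j) hs
  · simpa [Sub.get_comp, Sub.get_ren, Tm.sub] using congrArg (Sub.get · j) hr

theorem get_sus_susp {T : Tree} (Ts : Tree) (i : Fin2 (T.size + 2 + 1)) :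
    (cons T Ts).ctx.get (sus Ts i) = (T.ctx.susp.get i).sub (Sub.ren (sus Ts)) :=
  Ctx.wedge_get_wedgeL (a := T.size + 2) _ _ _ _ _

theorem get_first : (T : Tree) → T.ctx.get (firstVar T.size) = .star
  | nil => rfl
  | cons T Ts => by rw [← sus_north, get_sus_susp, Ctx.susp_get_north, Ty.sub]

theorem get_inn {T : Tree} (Ts : Tree) (i : Fin2 (T.size + 1)) :
    (cons T Ts).ctx.get (inn Ts i) = (T.ctx.get i).susp.sub (Sub.ren (sus Ts)) := by
  rw [← Ctx.susp_get]; exact get_sus_susp _ _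

theorem get_rst (T : Tree) {Ts : Tree} (i : Fin2 (Ts.size + 1)) :
    (cons T Ts).ctx.get (rst T i) = (Ts.ctx.get i).sub (Sub.ren (rst T)) :=
  Ctx.wedge_get_wedgeR (a := T.size + 2) _ _ (Ctx.susp_get_south _) _ _ (get_first _) _

end Tree

/-! ### Type-preserving renamings -/

/-- A substitution `σ : Γ → Δ` is a type-preserving renaming if it sends each variable of `Γ` to
a variable of `Δ` whose type is, syntactically, the image of the type of the former. -/
def Sub.IsIncl {m n : ℕ} (Δ : Ctx n) (σ : Sub m n) (Γ : Ctx m) : Prop :=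
  ∀ i, ∃ j, σ.get i = .var j ∧ Δ.get j = (Γ.get i).sub σ

theorem Sub.isIncl_id {n : ℕ} (Γ : Ctx n) : Sub.IsIncl Γ (Sub.id n) Γ :=
  fun i => ⟨i, Sub.get_id i, (Ty.sub_id _).symm⟩

theorem Sub.isIncl_ren {m n : ℕ} {Δ : Ctx n} {Γ : Ctx m} {f : Fin2 m → Fin2 n}
    (h : ∀ i, Δ.get (f i) = (Γ.get i).sub (Sub.ren f)) : Sub.IsIncl Δ (Sub.ren f) Γ :=
  fun i => ⟨f i, Sub.get_ren f i, h i⟩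

theorem Sub.IsIncl.comp {l m n : ℕ} {Θ : Ctx l} {Γ : Ctx m} {Δ : Ctx n} {τ : Sub l m}
    {σ : Sub m n} (hτ : Sub.IsIncl Γ τ Θ) (hσ : Sub.IsIncl Δ σ Γ) :
    Sub.IsIncl Δ (τ.comp σ) Θ := by
  intro i
  obtain ⟨j, hj, hj'⟩ := hτ i
  obtain ⟨k, hk, hk'⟩ := hσ j
  exact ⟨k, by rw [Sub.get_comp, hj, Tm.sub, hk], by rw [hk', hj', Ty.sub_sub]⟩

theorem Sub.IsIncl.susp {m n : ℕ} {Γ : Ctx m} {Δ : Ctx n} {σ : Sub m n}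
    (hσ : Sub.IsIncl Δ σ Γ) : Sub.IsIncl Δ.susp σ.susp Γ.susp := by
  intro i
  rcases suspVar_cases i with rfl | rfl | ⟨i, rfl⟩
  · exact ⟨_, Sub.susp_get_north σ, by simp [Ctx.susp_get_north, Ty.sub]⟩
  · exact ⟨_, Sub.susp_get_south σ, by simp [Ctx.susp_get_south, Ty.sub]⟩
  · obtain ⟨j, hj, hj'⟩ := hσ i
    exact ⟨suspVar j, by rw [Sub.susp_get, hj, Tm.susp],
      by rw [Ctx.susp_get, Ctx.susp_get, hj', Ty.susp_sub]⟩

namespace Tree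

theorem isIncl_sus (T Ts : Tree) :
    Sub.IsIncl (cons T Ts).ctx (Sub.ren (sus Ts)) T.ctx.susp :=
  Sub.isIncl_ren (get_sus_susp Ts)

theorem isIncl_rst (T Ts : Tree) : Sub.IsIncl (cons T Ts).ctx (Sub.ren (rst T)) Ts.ctx :=
  Sub.isIncl_ren (get_rst T)

/-- To give a type-preserving renaming out of `Σ⌊T⌋ ∨ ⌊Ts⌋`, it suffices to give one on each
summand. -/
theorem isIncl_of_cons {T Ts : Tree} {n : ℕ} {Δ : Ctx n} {σ : Sub ((cons T Ts).size + 1) n}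
    (h : Sub.IsIncl Δ ((Sub.ren (sus Ts)).comp σ) T.ctx.susp)
    (h' : Sub.IsIncl Δ ((Sub.ren (rst T)).comp σ) Ts.ctx) :
    Sub.IsIncl Δ σ (cons T Ts).ctx := by
  intro i
  rcases sus_or_rst i with ⟨j, rfl⟩ | ⟨j, rfl⟩
  · obtain ⟨k, hk, hk'⟩ := h j
    refine ⟨k, by rw [← hk, Sub.get_comp, Sub.get_ren, Tm.sub], ?_⟩
    rw [hk', ← Ty.sub_sub, get_sus_susp]
  · obtain ⟨k, hk, hk'⟩ := h' j
    refine ⟨k, by rw [← hk, Sub.get_comp, Sub.get_ren, Tm.sub], ?_⟩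
    rw [hk', ← Ty.sub_sub, get_rst]

theorem isIncl_pair {T Ts : Tree} {n : ℕ} {Δ : Ctx n} {σ : Sub (T.size + 2 + 1) n}
    {τ : Sub (Ts.size + 1) n} (h : τ.get (firstVar Ts.size) = σ.get (southVar (T.size + 1)))
    (hσ : Sub.IsIncl Δ σ T.ctx.susp) (hτ : Sub.IsIncl Δ τ Ts.ctx) :
    Sub.IsIncl Δ (pair σ τ) (cons T Ts).ctx :=
  isIncl_of_cons (by rwa [ren_sus_comp_pair]) (by rwa [ren_rst_comp_pair h])

end Tree

/-! ### Globular contexts -/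

/-- A type is globular over `Γ` if all its sources and targets are variables of `Γ` having,
syntactically, the expected types. -/
def Ty.Glob {n : ℕ} (Γ : Ctx n) : Ty n → Prop
  | .star => True
  | .arr s A t => (∃ i, s = .var i ∧ Γ.get i = A) ∧ (∃ i, t = .var i ∧ Γ.get i = A) ∧ A.Glob Γ

/-- A context is globular if all its types are. Such contexts are well-typed in every theory. -/
def Ctx.Glob : {n : ℕ} → Ctx n → Prop
  | _, .nil => True
  | _, .snoc Γ A => Γ.Glob ∧ A.Glob Γ

theorem Ty.Glob.wk {n : ℕ} {Γ : Ctx n} (B : Ty n) : {A : Ty n} → A.Glob Γ → A.wk.Glob (Γ.snoc B)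
  | .star, _ => trivial
  | .arr _ _ _, h => by
    obtain ⟨⟨i, rfl, hi'⟩, ⟨j, rfl, hj'⟩, h⟩ := h
    exact ⟨⟨.fs i, rfl, congrArg Ty.wk hi'⟩, ⟨.fs j, rfl, congrArg Ty.wk hj'⟩, h.wk B⟩

theorem Ctx.Glob.get : {n : ℕ} → {Γ : Ctx n} → Γ.Glob → (i : Fin2 n) → (Γ.get i).Glob Γ
  | _, .snoc _ A, h, .fz => h.2.wk A
  | _, .snoc _ A, h, .fs i => (h.1.get i).wk A

theorem Ty.Glob.susp {n : ℕ} {Γ : Ctx n} : {A : Ty n} → A.Glob Γ → A.susp.Glob Γ.susp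
  | .star, _ => ⟨⟨_, rfl, Γ.susp_get_north⟩, ⟨_, rfl, Γ.susp_get_south⟩, trivial⟩
  | .arr _ _ _, h => by
    obtain ⟨⟨i, rfl, hi'⟩, ⟨j, rfl, hj'⟩, h⟩ := h
    exact ⟨⟨_, rfl, by rw [Γ.susp_get, hi']⟩, ⟨_, rfl, by rw [Γ.susp_get, hj']⟩, h.susp⟩

theorem Ctx.Glob.susp : {n : ℕ} → {Γ : Ctx n} → Γ.Glob → Γ.susp.Glob
  | _, .nil, _ => ⟨⟨trivial, trivial⟩, trivial⟩
  | _, .snoc _ _, h => ⟨h.1.susp, h.2.susp⟩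

theorem Ty.Glob.sub {m n : ℕ} {Γ : Ctx m} {Δ : Ctx n} {σ : Sub m n} (hσ : Sub.IsIncl Δ σ Γ) :
    {A : Ty m} → A.Glob Γ → (A.sub σ).Glob Δ
  | .star, _ => by rw [Ty.sub]; trivial
  | .arr _ _ _, h => by
    obtain ⟨⟨i, rfl, hi'⟩, ⟨j, rfl, hj'⟩, h⟩ := h
    obtain ⟨k, hk, hk'⟩ := hσ i
    obtain ⟨l, hl, hl'⟩ := hσ j
    rw [Ty.sub]
    exact ⟨⟨k, hk, by rw [hk', hi']⟩, ⟨l, hl, by rw [hl', hj']⟩, h.sub hσ⟩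

theorem Ctx.Glob.wedge {a : ℕ} {Γ : Ctx (a + 1)} (hΓ : Γ.Glob) {x : Fin2 (a + 1)}
    (hx : Γ.get x = .star) : (b : ℕ) → (Δ : Ctx (b + 1)) → Δ.Glob → Δ.get (firstVar b) = .star →
    (Γ.wedge x b Δ).Glob
  | 0, _, _, _ => hΓ
  | b + 1, .snoc Δ A, h, h' => by
    exact ⟨Ctx.Glob.wedge hΓ hx b Δ h.1 (Ty.eq_star_of_wk h'),
      h.2.sub (Sub.isIncl_ren (Ctx.wedge_get_wedgeR Γ x hx b Δ (Ty.eq_star_of_wk h')))⟩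

theorem Tree.ctx_glob : (T : Tree) → T.ctx.Glob
  | nil => ⟨trivial, trivial⟩
  | cons T Ts => Ctx.Glob.wedge (a := T.size + 2) T.ctx_glob.susp (Ctx.susp_get_south _) _ _
      Ts.ctx_glob (get_first Ts)

theorem Ty.Glob.wf {n : ℕ} {Γ : Ctx n} (hΓ : WfCtx R Γ) : {A : Ty n} → A.Glob Γ → WfTy R Γ A
  | .star, _ => .star
  | .arr _ _ _, h => by
    obtain ⟨⟨i, rfl, hi'⟩, ⟨j, rfl, hj'⟩, h⟩ := h
    exact .arr (h.wf hΓ) (hi' ▸ HasTy.var i hΓ) (hj' ▸ HasTy.var j hΓ)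

theorem Ctx.Glob.wf : {n : ℕ} → {Γ : Ctx n} → Γ.Glob → WfCtx R Γ
  | _, .nil, _ => .nil
  | _, .snoc _ _, h => .snoc h.1.wf (h.2.wf h.1.wf)

theorem Tree.wf (T : Tree) : WfCtx R T.ctx := T.ctx_glob.wf

/-- A substitution is well-typed as soon as its value at each variable is. -/
theorem WfSub.of_get : {m n : ℕ} → {Γ : Ctx n} → {σ : Sub m n} → {Δ : Ctx m} → WfCtx R Δ →
    (∀ i, HasTy R Γ (σ.get i) ((Δ.get i).sub σ)) → WfSub R Γ σ Δ
  | _, _, _, .nil, .nil, _, _ => .nil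
  | _, _, _, .snoc σ t, .snoc Δ A, .snoc hΔ hA, h =>
    .snoc (WfSub.of_get hΔ fun i => by
      simpa only [Sub.get, Ctx.get, Ty.wk_sub] using h (.fs i)) hA
      (by simpa only [Sub.get, Ctx.get, Ty.wk_sub] using h .fz)

theorem Sub.IsIncl.wf {m n : ℕ} {Γ : Ctx m} {Δ : Ctx n} {σ : Sub m n} (h : Sub.IsIncl Δ σ Γ)
    (hΓ : WfCtx R Γ) (hΔ : WfCtx R Δ) : WfSub R Δ σ Γ :=
  WfSub.of_get hΓ fun i => by
    obtain ⟨j, hj, hj'⟩ := h i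
    rw [hj, ← hj']; exact .var j hΔ

/-! ### Free variables and supports -/

theorem Sub.mem_fv : {m n : ℕ} → {σ : Sub m n} → {i : Fin2 n} →
    (i ∈ σ.fv ↔ ∃ j, i ∈ (σ.get j).fv)
  | _, _, .nil, i => ⟨fun h => h.elim, fun ⟨j, _⟩ => nomatch j⟩
  | _, _, .snoc σ t, i => by
    rw [Sub.fv, Set.mem_union, Sub.mem_fv]
    constructor
    · rintro (⟨j, hj⟩ | h)
      exacts [⟨.fs j, hj⟩, ⟨.fz, h⟩]
    · rintro ⟨j | j, hj⟩
      exacts [.inr hj, .inl ⟨_, hj⟩]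

mutual

theorem Ty.mem_fv_sub : {m n : ℕ} → (A : Ty m) → (σ : Sub m n) → (i : Fin2 n) →
    (i ∈ (A.sub σ).fv ↔ ∃ j ∈ A.fv, i ∈ (σ.get j).fv)
  | _, _, .star, σ, i => by simp [Ty.sub, Ty.fv]
  | _, _, .arr s A t, σ, i => by
    simp only [Ty.sub, Ty.fv, Set.mem_union, Tm.mem_fv_sub s, Ty.mem_fv_sub A, Tm.mem_fv_sub t,
      or_and_right, exists_or]

theorem Tm.mem_fv_sub : {m n : ℕ} → (t : Tm m) → (σ : Sub m n) → (i : Fin2 n) →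
    (i ∈ (t.sub σ).fv ↔ ∃ j ∈ t.fv, i ∈ (σ.get j).fv)
  | _, _, .var j, σ, i => by simp [Tm.sub, Tm.fv]
  | _, _, .coh Δ A τ, σ, i => by simp only [Tm.sub, Tm.fv, Sub.mem_fv_comp τ]

theorem Sub.mem_fv_comp : {l m n : ℕ} → (τ : Sub l m) → (σ : Sub m n) → (i : Fin2 n) →
    (i ∈ (τ.comp σ).fv ↔ ∃ j ∈ τ.fv, i ∈ (σ.get j).fv)
  | _, _, _, .nil, σ, i => by simp [Sub.comp, Sub.fv]
  | _, _, _, .snoc τ t, σ, i => by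
    simp only [Sub.comp, Sub.fv, Set.mem_union, Sub.mem_fv_comp τ, Tm.mem_fv_sub t,
      or_and_right, exists_or]

end

theorem Ctx.subset_closure {n : ℕ} (Γ : Ctx n) (V : Set (Fin2 n)) : V ⊆ Γ.closure V :=
  fun _ hi _ hW => hW.1 hi

theorem Ctx.closure_subset {n : ℕ} {Γ : Ctx n} {V W : Set (Fin2 n)} (h : V ⊆ W)
    (hW : Γ.DownClosed W) : Γ.closure V ⊆ W :=
  Set.sInter_subset_of_mem ⟨h, hW⟩

theorem Ctx.downClosed_closure {n : ℕ} (Γ : Ctx n) (V : Set (Fin2 n)) :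
    Γ.DownClosed (Γ.closure V) :=
  fun _ hi _ hj W hW => hW.2 _ (hi W hW) hj

/-- The image of a term of full support under a type-preserving renaming has the support of the
renaming. -/
theorem Sub.IsIncl.supp_sub {m n : ℕ} {Γ : Ctx m} {Δ : Ctx n} {σ : Sub m n}
    (hσ : Sub.IsIncl Δ σ Γ) {t : Tm m} (ht : t.supp Γ = Set.univ) :
    (t.sub σ).supp Δ = σ.supp Δ := by
  apply subset_antisymm
  · refine Ctx.closure_subset (fun i hi => ?_) (Ctx.downClosed_closure _ _)
    obtain ⟨j, _, hj⟩ := (Tm.mem_fv_sub t σ i).1 hi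
    exact Ctx.subset_closure _ _ (Sub.mem_fv.2 ⟨j, hj⟩)
  · refine Ctx.closure_subset (fun i hi => ?_) (Ctx.downClosed_closure _ _)
    obtain ⟨j, hj⟩ := Sub.mem_fv.1 hi
    -- The variables of `Γ` whose image lies in the support of `t[σ]` form a down-closed set.
    have key : t.supp Γ ⊆ {j | (σ.get j).fv ⊆ (t.sub σ).supp Δ} := by
      refine Ctx.closure_subset (fun k hk l hl => ?_) fun k hk l hl => ?_
      · exact Ctx.subset_closure _ _ ((Tm.mem_fv_sub t σ l).2 ⟨k, hk, hl⟩)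
      · obtain ⟨k', hk', hk''⟩ := hσ k
        intro p hp
        refine Ctx.downClosed_closure _ _ k' (hk ?_) ?_
        · rw [hk']; rfl
        · rw [hk'', Ty.mem_fv_sub]; exact ⟨l, hl, hp⟩
    exact key (ht ▸ Set.mem_univ j) hj

theorem Sub.mem_fv_id {n : ℕ} (i : Fin2 n) : i ∈ (Sub.id n).fv :=
  Sub.mem_fv.2 ⟨i, by rw [Sub.get_id]; rfl⟩

mutual

theorem Ty.ends_mem_fv_susp : {n : ℕ} → (A : Ty n) →
    northVar n ∈ A.susp.fv ∧ southVar n ∈ A.susp.fv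
  | _, .star => ⟨.inl (.inl rfl), .inr rfl⟩
  | _, .arr _ A _ => ⟨.inl (.inr A.ends_mem_fv_susp.1), .inl (.inr A.ends_mem_fv_susp.2)⟩

theorem Ty.suspVar_mem_fv : {n : ℕ} → (A : Ty n) → {i : Fin2 n} → i ∈ A.fv → suspVar i ∈ A.susp.fv
  | _, .star, _, h => h.elim
  | _, .arr s A t, i, h => by
    rcases h with (h | h) | h
    exacts [.inl (.inl (s.suspVar_mem_fv h)), .inl (.inr (A.suspVar_mem_fv h)),
      .inr (t.suspVar_mem_fv h)]

theorem Tm.suspVar_mem_fv : {n : ℕ} → (t : Tm n) → {i : Fin2 n} → i ∈ t.fv → suspVar i ∈ t.susp.fv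
  | _, .var j, i, h => by
    obtain rfl : i = j := h
    exact rfl
  | _, .coh _ _ σ, i, h => σ.suspVar_mem_fv h

theorem Sub.suspVar_mem_fv : {m n : ℕ} → (σ : Sub m n) → {i : Fin2 n} → i ∈ σ.fv →
    suspVar i ∈ σ.susp.fv
  | _, _, .nil, _, h => h.elim
  | _, _, .snoc σ t, i, h => by
    rcases h with h | h
    exacts [.inl (σ.suspVar_mem_fv h), .inr (t.suspVar_mem_fv h)]

end

/-! ### Linear trees -/

theorem Tree.isLinear_cons_nil {T : Tree} : (cons T nil).IsLinear ↔ T.IsLinear := by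
  simp [IsLinear, th, dim]

/-- In a disc, every variable other than the top-dimensional one occurs in the type of the
latter. -/
theorem Tree.IsLinear.eq_or_mem_fv : {T : Tree} → T.IsLinear → (i : Fin2 (T.size + 1)) →
    i = .fz ∨ i ∈ (T.ctx.get .fz).fv
  | nil, _, .fz => .inl rfl
  | cons T nil, h, i => by
    have ih := Tree.IsLinear.eq_or_mem_fv (T := T) (isLinear_cons_nil.1 h)
    have hfz : (cons T nil).ctx.get .fz = (T.ctx.get .fz).susp := Ctx.susp_get T.ctx .fz
    rw [hfz]
    rcases suspVar_cases (n := T.size + 1) i with rfl | rfl | ⟨j, rfl⟩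
    · exact .inr (Ty.ends_mem_fv_susp _).1
    · exact .inr (Ty.ends_mem_fv_susp _).2
    · rcases ih j with rfl | hj
      · exact .inl rfl
      · exact .inr (Ty.suspVar_mem_fv _ hj)
  | cons T (cons T' Ts), h, _ => by simp [IsLinear, th, dim] at h; omega

theorem Tree.IsLinear.supp_top {T : Tree} (h : T.IsLinear) :
    (Tm.var .fz).supp T.ctx = Set.univ := by
  refine Set.eq_univ_of_forall fun i => ?_
  have hz := Ctx.subset_closure T.ctx (Tm.var .fz).fv (show Fin2.fz ∈ _ from rfl)
  rcases h.eq_or_mem_fv i with rfl | hi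
  · exact hz
  · exact Ctx.downClosed_closure _ _ _ hz hi

/-! ### Boundaries of trees -/

namespace Tree

theorem dim_bdry_le : (n : ℕ) → (T : Tree) → (bdry n T).dim ≤ n
  | 0, _ => le_rfl
  | _ + 1, nil => Nat.zero_le _
  | n + 1, cons T Ts =>
    max_le (Nat.succ_le_succ (dim_bdry_le n T)) (dim_bdry_le (n + 1) Ts)

theorem bdry_bdry : (j k : ℕ) → j ≤ k → (T : Tree) → bdry j (bdry k T) = bdry j T
  | 0, _, _, _ => rfl
  | _ + 1, _ + 1, _, nil => rfl
  | j + 1, k + 1, h, cons T Ts =>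
    congrArg₂ cons (bdry_bdry j k (Nat.le_of_succ_le_succ h) T) (bdry_bdry (j + 1) (k + 1) h Ts)

theorem bdry_of_dim_le : (n : ℕ) → (T : Tree) → T.dim ≤ n → bdry n T = T
  | 0, nil, _ => rfl
  | 0, cons _ _, h => by simp [dim] at h
  | _ + 1, nil, _ => rfl
  | n + 1, cons T Ts, h => by
    simp only [dim, max_le_iff] at h
    exact congrArg₂ cons (bdry_of_dim_le n T (by omega)) (bdry_of_dim_le (n + 1) Ts h.2)

theorem inc_succ_cons (ε : Bool) (n : ℕ) (T Ts : Tree) : inc ε (n + 1) (cons T Ts) =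
    pair (T := bdry n T) (Ts := bdry (n + 1) Ts) ((inc ε n T).susp.comp (Sub.ren (sus Ts)))
      ((inc ε (n + 1) Ts).comp (Sub.ren (rst T))) := rfl

theorem inc_succ_first (ε : Bool) (n : ℕ) : (T : Tree) →
    (inc ε (n + 1) T).get (firstVar _) = .var (firstVar _)
  | nil => rfl
  | cons T Ts => by
    rw [inc_succ_cons]
    refine (pair_first _ _).trans ?_
    rw [Sub.get_comp, Sub.susp_get_north, Tm.sub, Sub.get_ren, sus_north]

theorem ren_rst_first (ε : Bool) (n : ℕ) (T Ts : Tree) :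
    ((inc ε (n + 1) Ts).comp (Sub.ren (rst T))).get (firstVar _) =
      ((inc ε n T).susp.comp (Sub.ren (sus Ts))).get (southVar _) := by
  rw [Sub.get_comp, Sub.get_comp, Sub.susp_get_south, inc_succ_first, Tm.sub, Tm.sub,
    Sub.get_ren, Sub.get_ren, sus_south]

theorem get_lastVtx : (T : Tree) → T.ctx.get T.lastVtx = .star
  | nil => rfl
  | cons T Ts => by
    refine (get_rst T Ts.lastVtx).trans ?_
    rw [get_lastVtx Ts, Ty.sub]

theorem inc_zero (ε : Bool) (T : Tree) :
    inc ε 0 T = .snoc .nil (.var (bif ε then T.lastVtx else firstVar T.size)) := by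
  rw [inc]

theorem isIncl_inc (ε : Bool) : (n : ℕ) → (T : Tree) →
    Sub.IsIncl T.ctx (inc ε n T) (bdry n T).ctx
  | 0, T => fun
    | .fz => by
      rw [inc_zero]
      cases ε
      · exact ⟨_, rfl, get_first T⟩
      · exact ⟨_, rfl, get_lastVtx T⟩
  | n + 1, nil => Sub.isIncl_id _
  | n + 1, cons T Ts => by
    rw [inc_succ_cons]
    exact isIncl_pair (ren_rst_first ε n T Ts)
      ((isIncl_inc ε n T).susp.comp (isIncl_sus T Ts))
      ((isIncl_inc ε (n + 1) Ts).comp (isIncl_rst T Ts))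

theorem heq_pair {T T' Ts Ts' : Tree} {k : ℕ} (hT : T = T') (hTs : Ts = Ts')
    {σ : Sub (T.size + 2 + 1) k} {σ' : Sub (T'.size + 2 + 1) k} {τ : Sub (Ts.size + 1) k}
    {τ' : Sub (Ts'.size + 1) k} (hσ : σ ≍ σ') (hτ : τ ≍ τ') :
    (pair σ τ : Sub ((cons T Ts).size + 1) k) ≍ (pair σ' τ' : Sub ((cons T' Ts').size + 1) k) := by
  subst hT hTs hσ hτ; rfl

theorem heq_comp {T T' : Tree} (hT : T = T') {m n : ℕ} {σ : Sub (T.size + 1) m}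
    {σ' : Sub (T'.size + 1) m} (hσ : σ ≍ σ') (τ : Sub m n) : σ.comp τ ≍ σ'.comp τ := by
  subst hT hσ; rfl

theorem heq_susp_comp {T T' : Tree} (hT : T = T') {m n : ℕ} {σ : Sub (T.size + 1) m}
    {σ' : Sub (T'.size + 1) m} (hσ : σ ≍ σ') (τ : Sub (m + 2) n) :
    σ.susp.comp τ ≍ σ'.susp.comp τ := by
  subst hT hσ; rfl

theorem pair_comp {T Ts : Tree} {k l : ℕ} {σ : Sub (T.size + 2 + 1) k} {τ : Sub (Ts.size + 1) k}
    (h : τ.get (firstVar Ts.size) = σ.get (southVar (T.size + 1))) (ρ : Sub k l) :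
    (pair σ τ).comp ρ = pair (σ.comp ρ) (τ.comp ρ) := by
  refine ext_cons ?_ ?_
  · rw [← Sub.comp_assoc, ren_sus_comp_pair, ren_sus_comp_pair]
  · rw [← Sub.comp_assoc, ren_rst_comp_pair h, ren_rst_comp_pair]
    rw [Sub.get_comp, Sub.get_comp, h]

theorem lastVtx_inc_succ (ε : Bool) (n : ℕ) : (T : Tree) →
    (inc ε (n + 1) T).get (lastVtx _) = .var (lastVtx _)
  | nil => rfl
  | cons T Ts => by
    rw [inc_succ_cons]
    refine (pair_rst (ren_rst_first ε n T Ts) (bdry (n + 1) Ts).lastVtx).trans ?_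
    rw [Sub.get_comp, lastVtx_inc_succ ε n Ts, Tm.sub, Sub.get_ren]; rfl

/-- Globularity: the inclusions of iterated boundaries compose to inclusions of boundaries. The
equality is heterogeneous because the trees `bdry j (bdry k T)` and `bdry j T` agree only
propositionally. -/
theorem inc_comp_inc (δ ε : Bool) : (j k : ℕ) → j < k → (T : Tree) →
    (inc δ j (bdry k T)).comp (inc ε k T) ≍ inc δ j T
  | 0, k + 1, _, T => by
    refine heq_of_eq (Sub.ext_get _ _ fun | .fz => ?_)
    rw [inc_zero, inc_zero]
    cases δ
    · exact inc_succ_first ε k T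
    · exact lastVtx_inc_succ ε k T
  | j + 1, k + 1, _, nil => heq_of_eq (Sub.comp_id _)
  | j + 1, k + 1, h, cons T Ts => by
    have e1 : (inc δ (j + 1) (bdry (k + 1) (cons T Ts))).comp (inc ε (k + 1) (cons T Ts)) =
        pair (T := bdry j (bdry k T)) (Ts := bdry (j + 1) (bdry (k + 1) Ts))
          (((inc δ j (bdry k T)).comp (inc ε k T)).susp.comp (Sub.ren (sus Ts)))
          (((inc δ (j + 1) (bdry (k + 1) Ts)).comp (inc ε (k + 1) Ts)).comp (Sub.ren (rst T))) := by
      rw [inc_succ_cons ε]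
      refine (pair_comp (ren_rst_first δ j (bdry k T) (bdry (k + 1) Ts)) _).trans ?_
      congr 1
      · rw [Sub.comp_assoc, Sub.susp_comp, Sub.comp_assoc]
        exact congrArg _ (ren_sus_comp_pair _ _)
      · rw [Sub.comp_assoc, Sub.comp_assoc]
        exact congrArg _ (ren_rst_comp_pair (ren_rst_first ε k T Ts))
    rw [e1, inc_succ_cons]
    have hT := bdry_bdry j k (by omega) T
    have hTs := bdry_bdry (j + 1) (k + 1) h.le Ts
    exact heq_pair hT hTs (heq_susp_comp hT (inc_comp_inc δ ε j k (by omega) T) _)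
      (heq_comp hTs (inc_comp_inc δ ε (j + 1) (k + 1) h Ts) _)

/-- A tree of dimension at most `n` is its own `n`-dimensional boundary. -/
theorem inc_of_dim_le (ε : Bool) : (n : ℕ) → (T : Tree) → T.dim ≤ n →
    inc ε n T ≍ Sub.id (T.size + 1)
  | 0, nil, _ => by cases ε <;> rfl
  | 0, cons _ _, h => by simp [dim] at h
  | _ + 1, nil, _ => .rfl
  | n + 1, cons T Ts, h => by
    simp only [dim, max_le_iff] at h
    have e : Sub.id ((cons T Ts).size + 1) = pair ((Sub.id (T.size + 1)).susp.comp
        (Sub.ren (sus Ts))) ((Sub.id (Ts.size + 1)).comp (Sub.ren (rst T))) := by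
      refine ext_cons ?_ ?_
      · rw [ren_sus_comp_pair, Sub.susp_id, Sub.id_comp, Sub.comp_id]
      · rw [ren_rst_comp_pair, Sub.id_comp, Sub.comp_id]
        rw [Sub.susp_id, Sub.id_comp, Sub.id_comp, Sub.get_ren, Sub.get_ren, sus_south]
    rw [inc_succ_cons, e]
    have hT := bdry_of_dim_le n T (by omega)
    have hTs := bdry_of_dim_le (n + 1) Ts h.2
    exact heq_pair hT hTs (heq_susp_comp hT (inc_of_dim_le ε n T (by omega)) _)
      (heq_comp hTs (inc_of_dim_le ε (n + 1) Ts h.2) _)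

end Tree

/-! ### Discs and substitutions out of them -/

/-- The substitution of `Ty.toSub`, indexed by a number known to be the dimension of the type. -/
def Ty.toSubN {k : ℕ} (n : ℕ) (A : Ty k) (h : A.dim = n) : Sub (2 * n) k :=
  A.toSub.cast (by rw [h])

/-- The substitution `{A, t} : Dⁿ → Γ` for a type `A` of dimension `n`. -/
def discSubN {k : ℕ} (n : ℕ) (A : Ty k) (h : A.dim = n) (t : Tm k) : Sub (2 * n + 1) k :=
  (A.toSubN n h).snoc t

theorem Ty.toSubN_arr {k : ℕ} (n : ℕ) (s t : Tm k) (A : Ty k) (h : (Ty.arr s A t).dim = n + 1) :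
    (Ty.arr s A t).toSubN (n + 1) h = ((A.toSubN n (Nat.succ.inj h)).snoc s).snoc t := by
  obtain rfl : A.dim = n := Nat.succ.inj h
  rfl

theorem discSub_cast {k : ℕ} {n m : ℕ} {A : Ty k} (h : A.dim = n) (t : Tm k)
    (e : 2 * A.dim + 1 = m) (e' : 2 * n + 1 = m) :
    (discSub A t).cast e = (discSubN n A h t).cast e' := by
  subst h e; rfl

theorem Tree.unbSub_eq (n : ℕ) (T : Tree) :
    T.unbSub n = discSubN n (unbTy n T) (dim_unbTy n T) (unbCoh n T) :=
  discSub_cast (dim_unbTy n T) _ _ rfl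

theorem Ty.toSubN_comp {k l : ℕ} (σ : Sub k l) : (n : ℕ) → (A : Ty k) → (h : A.dim = n) →
    (A.toSubN n h).comp σ = (A.sub σ).toSubN n ((A.dim_sub σ).trans h)
  | 0, .star, _ => by simp only [Ty.sub]; rfl
  | n + 1, .arr s A t, h => by
    simp only [Ty.sub]
    rw [Ty.toSubN_arr, Ty.toSubN_arr, Sub.comp, Sub.comp, Ty.toSubN_comp σ n A]

theorem discSubN_comp {k l : ℕ} (σ : Sub k l) (n : ℕ) (A : Ty k) (h : A.dim = n) (t : Tm k) :
    (discSubN n A h t).comp σ = discSubN n (A.sub σ) ((A.dim_sub σ).trans h) (t.sub σ) := by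
  rw [discSubN, Sub.comp, Ty.toSubN_comp]; rfl

theorem discSubN_congr {k : ℕ} {n : ℕ} {A B : Ty k} (hA : A.dim = n) (hB : B.dim = n) {s t : Tm k}
    (h : A = B) (h' : s = t) : discSubN n A hA s = discSubN n B hB t := by
  subst h h'; rfl

theorem sphere_glob : (n : ℕ) → (sphere n).1.Glob ∧ (sphere n).2.Glob (sphere n).1
  | 0 => ⟨trivial, trivial⟩
  | n + 1 =>
    ⟨⟨sphere_glob n, (sphere_glob n).2.wk _⟩, ⟨.fs .fz, rfl, rfl⟩, ⟨.fz, rfl, rfl⟩,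
      ((sphere_glob n).2.wk _).wk _⟩

theorem disc_wf (n : ℕ) : WfCtx R (disc n) :=
  Ctx.Glob.wf (Γ := disc n) (sphere_glob n)

theorem sphere_wf (n : ℕ) : WfTy R (sphere n).1 (sphere n).2 :=
  (sphere_glob n).2.wf (sphere_glob n).1.wf

theorem sphere_sub_toSubN {k : ℕ} : (n : ℕ) → (A : Ty k) → (h : A.dim = n) →
    (sphere n).2.sub (A.toSubN n h) = A
  | 0, .star, _ => by simp only [sphere, Ty.sub]
  | n + 1, .arr s A t, h => by
    rw [Ty.toSubN_arr]
    simp only [sphere, Ty.sub, Tm.sub, Sub.get, Ty.wk_sub, sphere_sub_toSubN n A]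

theorem Sub.IsIncl.snoc {m n : ℕ} {Γ : Ctx m} {Δ : Ctx n} {σ : Sub m n} (hσ : Sub.IsIncl Δ σ Γ)
    {A : Ty m} {j : Fin2 n} (h : Δ.get j = A.sub σ) :
    Sub.IsIncl Δ (σ.snoc (.var j)) (Γ.snoc A)
  | .fz => ⟨j, rfl, by rw [Ctx.get, Ty.wk_sub, h]⟩
  | .fs i => by
    obtain ⟨k, hk, hk'⟩ := hσ i
    exact ⟨k, hk, by rw [Ctx.get, Ty.wk_sub, hk']⟩

theorem Ty.Glob.isIncl_toSubN {k : ℕ} {Γ : Ctx k} : (n : ℕ) → (A : Ty k) → (h : A.dim = n) →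
    A.Glob Γ → Sub.IsIncl Γ (A.toSubN n h) (sphere n).1
  | 0, .star, _, _ => fun i => nomatch i
  | n + 1, .arr _ A _, h, hA => by
    obtain ⟨⟨i, rfl, hi⟩, ⟨j, rfl, hj⟩, hA⟩ := hA
    rw [Ty.toSubN_arr]
    refine ((hA.isIncl_toSubN n A _).snoc ?_).snoc ?_
    · rw [hi, sphere_sub_toSubN]
    · rw [hj, Ty.wk_sub, sphere_sub_toSubN]

theorem isIncl_discSubN {k : ℕ} {Γ : Ctx k} (hΓ : Γ.Glob) (n : ℕ) (i : Fin2 k)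
    (h : (Γ.get i).dim = n) : Sub.IsIncl Γ (discSubN n (Γ.get i) h (.var i)) (disc n) :=
  ((hΓ.get i).isIncl_toSubN n _ h).snoc (sphere_sub_toSubN n _ h).symm

/-- Every variable occurring in a globular type `A` is a value of the substitution `{A, t}`. -/
theorem Ty.Glob.exists_get_toSubN {k : ℕ} {Γ : Ctx k} : (n : ℕ) → (A : Ty k) → (h : A.dim = n) →
    A.Glob Γ → ∀ i ∈ A.fv, ∃ d, (A.toSubN n h).get d = .var i
  | 0, .star, _, _, _, hi => hi.elim
  | n + 1, .arr _ A _, h, hA, i, hi => by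
    obtain ⟨⟨j, rfl, -⟩, ⟨k, rfl, -⟩, hA⟩ := hA
    rw [Ty.toSubN_arr]
    rcases hi with (hi | hi) | hi
    · obtain rfl : i = j := hi
      exact ⟨.fs .fz, rfl⟩
    · obtain ⟨d, hd⟩ := hA.exists_get_toSubN n A (Nat.succ.inj h) i hi
      exact ⟨.fs (.fs d), hd⟩
    · obtain rfl : i = k := hi
      exact ⟨.fz, rfl⟩

theorem WfTy.toSubN {k : ℕ} {Γ : Ctx k} : (n : ℕ) → (A : Ty k) → (h : A.dim = n) → WfTy R Γ A →
    WfSub R Γ (A.toSubN n h) (sphere n).1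
  | 0, .star, _, _ => .nil
  | n + 1, .arr _ A _, h, .arr hA hs ht => by
    rw [Ty.toSubN_arr]
    refine .snoc (.snoc (hA.toSubN n A _) (sphere_wf n) ?_)
      (((sphere_glob n).2.wk _).wf (disc_wf n)) ?_
    · rwa [sphere_sub_toSubN]
    · rwa [Ty.wk_sub, sphere_sub_toSubN]

theorem WfSub.discSubN {k : ℕ} {Γ : Ctx k} {n : ℕ} {A : Ty k} {t : Tm k} (h : A.dim = n)
    (hA : WfTy R Γ A) (ht : HasTy R Γ t A) : WfSub R Γ (discSubN n A h t) (disc n) :=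
  .snoc (hA.toSubN n A h) (sphere_wf n) (by rwa [sphere_sub_toSubN])

theorem EqTy.toSubN {k : ℕ} {Γ : Ctx k} : (n : ℕ) → {A B : Ty k} → (hA : A.dim = n) →
    (hB : B.dim = n) → EqTy R Γ A B → EqSub R Γ (A.toSubN n hA) (B.toSubN n hB)
  | 0, _, _, _, _, .star => .nil
  | n + 1, _, _, hA, hB, .arr h1 h2 h3 => by
    rw [Ty.toSubN_arr, Ty.toSubN_arr]
    exact .snoc (.snoc (h3.toSubN n _ _) h1) h2

theorem sphere_susp : (n : ℕ) →
    (sphere n).1.susp = (sphere (n + 1)).1 ∧ (sphere n).2.susp = (sphere (n + 1)).2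
  | 0 => ⟨rfl, rfl⟩
  | n + 1 => by
    obtain ⟨h1, h2⟩ := sphere_susp n
    constructor
    · change (((sphere n).1.susp).snoc (sphere n).2.susp).snoc (sphere n).2.wk.susp = _
      rw [Ty.susp_wk, h1, h2]; rfl
    · change Ty.arr _ (sphere n).2.wk.wk.susp _ = _
      rw [Ty.susp_wk, Ty.susp_wk, h2]; rfl

theorem disc_susp (n : ℕ) : (disc n).susp = disc (n + 1) := by
  change (sphere n).1.susp.snoc (sphere n).2.susp = _
  rw [(sphere_susp n).1, (sphere_susp n).2]; rfl

theorem Tree.IsLinear.ctx_heq : {T : Tree} → T.IsLinear → T.ctx ≍ disc T.dim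
  | nil, _ => .rfl
  | cons T nil, h => by
    have hT := isLinear_cons_nil.1 h
    have ih := hT.ctx_heq
    have key : ∀ (m n : ℕ) (Γ : Ctx (m + 1)), m = 2 * n → Γ ≍ disc n →
        Γ.susp ≍ disc (n + 1) := by
      rintro _ n Γ rfl h
      rw [eq_of_heq h, disc_susp]
    have hd : (cons T nil).dim = T.dim + 1 := by simp [dim]
    rw [hd]
    exact key _ _ _ hT.size_eq ih
  | cons T (cons T' Ts), h => by simp [IsLinear, th, dim] at h; omega

/-- The type of the top-dimensional variable of a disc is sent to `A` by `{A, t}`. -/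
theorem Tree.IsLinear.get_top_sub {T : Tree} (hT : T.IsLinear) {k n : ℕ} (hn : n = T.dim)
    (A : Ty k) (h : A.dim = n) (t : Tm k) (e : 2 * n + 1 = T.size + 1) :
    (T.ctx.get .fz).sub ((discSubN n A h t).cast e) = A := by
  subst hn
  have key : ∀ (m n : ℕ) (Γ : Ctx (m + 1)) (e : 2 * n + 1 = m + 1) (h : A.dim = n), Γ ≍ disc n →
      (Γ.get .fz).sub ((discSubN n A h t).cast e) = A := by
    rintro m n Γ e h hΓ
    obtain rfl : 2 * n = m := Nat.succ.inj e
    rw [eq_of_heq hΓ]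
    change (sphere n).2.wk.sub ((A.toSubN n h).snoc t) = A
    rw [Ty.wk_sub, sphere_sub_toSubN]
  exact key _ _ _ e h hT.ctx_heq

/-! ### Unbiased types and coherences -/

namespace Tree

/-- The unbiased term `𝒯_T^n`. -/
def unbTm (n : ℕ) (T : Tree) : Tm (T.size + 1) :=
  if T.IsLinear ∧ T.dim = n then .var .fz else T.cohOf (unbTy n T)

theorem unbTy_succ (n : ℕ) (T : Tree) : unbTy (n + 1) T =
    .arr ((unbTm n (bdry n T)).sub (inc false n T)) (unbTy n T)
      ((unbTm n (bdry n T)).sub (inc true n T)) := rfl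

theorem unbTm_sub_congr {B B' : Tree} (h : B = B') {k : ℕ} {σ : Sub (B.size + 1) k}
    {σ' : Sub (B'.size + 1) k} (hσ : σ ≍ σ') (n : ℕ) :
    (unbTm n B).sub σ = (unbTm n B').sub σ' := by
  subst h hσ; rfl

/-- Unbiased types are compatible with the inclusions of boundaries. -/
theorem unbTy_bdry_sub_inc (ε : Bool) (k : ℕ) (T : Tree) : (j : ℕ) → j ≤ k →
    (unbTy j (bdry k T)).sub (inc ε k T) = unbTy j T
  | 0, _ => by simp only [unbTy, Ty.sub]
  | j + 1, h => by
    rw [unbTy_succ, unbTy_succ, Ty.sub, unbTy_bdry_sub_inc ε k T j (by omega), Tm.sub_sub,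
      Tm.sub_sub, unbTm_sub_congr (bdry_bdry j k (by omega) T) (inc_comp_inc false ε j k h T),
      unbTm_sub_congr (bdry_bdry j k (by omega) T) (inc_comp_inc true ε j k h T)]

theorem inc_succ_cons_nil (ε : Bool) (n : ℕ) (T : Tree) :
    inc ε (n + 1) (cons T nil) = (inc ε n T).susp :=
  Sub.comp_id _

theorem cohOf_susp (T : Tree) (U : Ty (T.size + 1)) :
    (cons T nil).cohOf U.susp = (T.cohOf U).susp :=
  congrArg (Tm.coh T.ctx.susp U.susp) (Sub.susp_id _).symm

theorem unbTm_susp_of {n : ℕ} {T : Tree} (h : unbTy (n + 1) (cons T nil) = (unbTy n T).susp) :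
    unbTm (n + 1) (cons T nil) = (unbTm n T).susp := by
  have hd : (cons T nil).IsLinear ∧ (cons T nil).dim = n + 1 ↔ T.IsLinear ∧ T.dim = n := by
    rw [isLinear_cons_nil]; simp [dim]
  by_cases hc : T.IsLinear ∧ T.dim = n
  · have e : unbTm n T = .var .fz := if_pos hc
    exact (if_pos (hd.2 hc)).trans (congrArg Tm.susp e).symm
  · have e : unbTm n T = T.cohOf (unbTy n T) := if_neg hc
    exact ((if_neg (mt hd.1 hc)).trans (congrArg _ h)).trans
      ((cohOf_susp T _).trans (congrArg Tm.susp e).symm)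

theorem unbTy_susp : (n : ℕ) → (T : Tree) → unbTy (n + 1) (cons T nil) = (unbTy n T).susp
  | 0, T => by
    rw [unbTy_succ, inc_zero, inc_zero, ← sus_north]; rfl
  | n + 1, T => by
    have hs : ∀ ε, (unbTm (n + 1) (bdry (n + 1) (cons T nil))).sub (inc ε (n + 1) (cons T nil)) =
        ((unbTm n (bdry n T)).sub (inc ε n T)).susp := fun ε =>
      (congrArg₂ Tm.sub (unbTm_susp_of (unbTy_susp n (bdry n T))) (inc_succ_cons_nil ε n T)).trans
        (Tm.susp_sub _ _).symm
    exact congr (congrArg₂ Ty.arr (hs false) (unbTy_susp n T)) (hs true)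

theorem unbCoh_susp (n : ℕ) (T : Tree) :
    unbCoh (n + 1) (cons T nil) = (unbCoh n T).susp :=
  (congrArg _ (unbTy_susp n T)).trans (cohOf_susp T _)

/-- Over a disc, the unbiased type is the type of the top-dimensional variable. -/
theorem IsLinear.get_top : {T : Tree} → T.IsLinear → T.ctx.get .fz = unbTy T.dim T
  | nil, _ => rfl
  | cons T nil, h => by
    have hd : (cons T nil).dim = T.dim + 1 := by simp [dim]
    rw [hd, unbTy_susp, ← (isLinear_cons_nil.1 h).get_top]
    exact Ctx.susp_get T.ctx .fz
  | cons T (cons T' Ts), h => by simp [IsLinear, th, dim] at h; omega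

theorem supp_unbTm (n : ℕ) (T : Tree) : (unbTm n T).supp T.ctx = Set.univ := by
  rw [unbTm]
  split
  · next h => exact h.1.supp_top
  · exact Set.eq_univ_of_forall fun i => Ctx.subset_closure _ _ (Sub.mem_fv_id i)

theorem supp_unbTm_sub_inc (ε : Bool) (n : ℕ) (T : Tree) :
    ((unbTm n (bdry n T)).sub (inc ε n T)).supp T.ctx = (inc ε n T).supp T.ctx :=
  (isIncl_inc ε n T).supp_sub (supp_unbTm n _)

theorem supp_inc_of_dim_le (ε : Bool) {n : ℕ} {T : Tree} (h : T.dim ≤ n) :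
    (inc ε n T).supp T.ctx = Set.univ := by
  have key : ∀ {B : Tree} (_ : B = T) {σ : Sub (B.size + 1) (T.size + 1)},
      σ ≍ Sub.id (T.size + 1) → σ.supp T.ctx = Set.univ := by
    rintro _ rfl σ hσ
    rw [eq_of_heq hσ]
    exact Set.eq_univ_of_forall fun i => Ctx.subset_closure _ _ (Sub.mem_fv_id i)
  exact key (bdry_of_dim_le n T h) (inc_of_dim_le ε n T h)

/-- The unbiased coherence is well-typed once its type is: if `T` has dimension `n + 1` then source
and target are supported on the two boundaries, and otherwise they have full support. -/
theorem unbCoh_hasTy_of [R.Tame] {n : ℕ} {T : Tree} (hT : T.dim ≤ n + 1)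
    (h : WfTy R T.ctx (unbTy (n + 1) T)) : HasTy R T.ctx (unbCoh (n + 1) T) (unbTy (n + 1) T) := by
  have key : HasTy R T.ctx (unbCoh (n + 1) T) ((unbTy (n + 1) T).sub (Sub.id _)) := by
    rw [unbTy_succ] at h
    by_cases hd : T.dim = n + 1
    · exact HasTy.comp T n hd h (WfSub.id T.wf) (supp_unbTm_sub_inc _ _ _)
        (supp_unbTm_sub_inc _ _ _)
    · have hd' : T.dim ≤ n := by omega
      exact HasTy.full T h (WfSub.id T.wf)
        ((supp_unbTm_sub_inc _ _ _).trans (supp_inc_of_dim_le _ hd'))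
        ((supp_unbTm_sub_inc _ _ _).trans (supp_inc_of_dim_le _ hd'))
  rwa [Ty.sub_id] at key

theorem unbTm_hasTy_of [R.Tame] : {n : ℕ} → {T : Tree} → T.dim ≤ n →
    WfTy R T.ctx (unbTy n T) → HasTy R T.ctx (unbTm n T) (unbTy n T) := by
  intro n T hT h
  rw [unbTm]
  split
  · next hl =>
    obtain ⟨hl, rfl⟩ := hl
    rw [← hl.get_top]
    exact .var _ T.wf
  · next hl =>
    cases n with
    | zero =>
      cases T with
      | nil => exact absurd ⟨rfl, rfl⟩ hl
      | cons => simp [dim] at hT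
    | succ n => exact unbCoh_hasTy_of hT h

theorem unbTy_wf [R.Tame] : (n : ℕ) → (T : Tree) → WfTy R T.ctx (unbTy n T)
  | 0, _ => .star
  | n + 1, T => by
    have h : ∀ ε, HasTy R T.ctx ((unbTm n (bdry n T)).sub (inc ε n T)) (unbTy n T) := fun ε => by
      rw [← unbTy_bdry_sub_inc ε n T n le_rfl]
      exact (unbTm_hasTy_of (dim_bdry_le n T) (unbTy_wf n _)).sub
        ((isIncl_inc ε n T).wf (bdry n T).wf T.wf)
    exact .arr (unbTy_wf n T) (h false) (h true)

theorem unbSub_wf [R.Tame] {n : ℕ} (hn : n ≠ 0) {T : Tree} (hT : T.dim ≤ n) :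
    WfSub R T.ctx (T.unbSub n) (disc n) := by
  obtain ⟨n, rfl⟩ := Nat.exists_eq_succ_of_ne_zero hn
  rw [unbSub_eq]
  exact WfSub.discSubN _ (unbTy_wf _ T) (unbCoh_hasTy_of hT (unbTy_wf _ T))

theorem toSubN_unbTy_ends (T : Tree) : (n : ℕ) →
    ((unbTy (n + 1) T).toSubN (n + 1) (dim_unbTy _ T)).get (northVar (2 * n)) =
        .var (firstVar T.size) ∧
      ((unbTy (n + 1) T).toSubN (n + 1) (dim_unbTy _ T)).get (southVar (2 * n)) =
        .var T.lastVtx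
  | 0 => by
    simp only [unbTy_succ, inc_zero]
    exact ⟨rfl, rfl⟩
  | n + 1 => by
    have ih := toSubN_unbTy_ends T n
    simp only [unbTy_succ (n + 1)]
    rw [Ty.toSubN_arr]
    exact ih

end Tree

/-! ### Uniqueness of types -/

theorem EqTy.symm : {n : ℕ} → {Γ : Ctx n} → {A B : Ty n} → EqTy R Γ A B → EqTy R Γ B A
  | _, _, _, _, .star => .star
  | _, _, _, _, .arr h1 h2 h3 => .arr h1.symm h2.symm h3.symm

theorem EqTy.trans : {n : ℕ} → {Γ : Ctx n} → {A B C : Ty n} → EqTy R Γ A B → EqTy R Γ B C →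
    EqTy R Γ A C
  | _, _, _, _, _, .star, .star => .star
  | _, _, _, _, _, .arr h1 h2 h3, .arr k1 k2 k3 => .arr (h1.trans k1) (h2.trans k2) (h3.trans k3)

/-- The type of a term that is read off from its outermost constructor. -/
def Tm.canonTy {n : ℕ} (Γ : Ctx n) : Tm n → Ty n
  | .var i => Γ.get i
  | .coh _ A σ => A.sub σ

theorem HasTy.eqTy_canonTy : {n : ℕ} → {Γ : Ctx n} → {t : Tm n} → {A : Ty n} → HasTy R Γ t A →
    EqTy R Γ (t.canonTy Γ) A
  | _, _, _, _, .var _ _ => EqTy.refl _ _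
  | _, _, _, _, .comp _ _ _ _ _ _ _ => by simp only [Tm.canonTy, Ty.sub]; exact EqTy.refl _ _
  | _, _, _, _, .full _ _ _ _ _ => by simp only [Tm.canonTy, Ty.sub]; exact EqTy.refl _ _
  | _, _, _, _, .conv h h' => h.eqTy_canonTy.trans h'

theorem HasTy.eqTy {n : ℕ} {Γ : Ctx n} {t : Tm n} {A B : Ty n} (hA : HasTy R Γ t A)
    (hB : HasTy R Γ t B) : EqTy R Γ A B :=
  hA.eqTy_canonTy.symm.trans hB.eqTy_canonTy

/-! ### Labellings as substitutions -/

namespace Label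

theorem unsusp_north {k : ℕ} (s t : Tm k) : {m : ℕ} → (σ : Sub m k) →
    (unsusp s t σ).get (northVar m) = s
  | _, .nil => rfl
  | _, .snoc σ _ => unsusp_north s t σ

theorem unsusp_south {k : ℕ} (s t : Tm k) : {m : ℕ} → (σ : Sub m k) →
    (unsusp s t σ).get (southVar m) = t
  | _, .nil => rfl
  | _, .snoc σ _ => unsusp_south s t σ

theorem unsusp_suspVar {k : ℕ} (s t : Tm k) : {m : ℕ} → (σ : Sub m k) → (i : Fin2 m) →
    (unsusp s t σ).get (suspVar i) = σ.get i
  | _, .snoc _ _, .fz => rfl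
  | _, .snoc σ _, .fs i => unsusp_suspVar s t σ i

theorem toSub_cons {k : ℕ} {T Ts : Tree} (t : Tm k) (L : Label k T) (Ls : Label k Ts) :
    (cons t L Ls).toSub = pair (unsusp t Ls.first L.toSub) Ls.toSub := rfl

theorem toSub_get_first {k : ℕ} : {T : Tree} → (L : Label k T) →
    L.toSub.get (firstVar T.size) = L.first
  | _, nil _ => rfl
  | _, cons t L Ls => by rw [toSub_cons, pair_first, unsusp_north]; rfl

theorem toSub_get_inn {k : ℕ} {T Ts : Tree} (t : Tm k) (L : Label k T) (Ls : Label k Ts)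
    (i : Fin2 (T.size + 1)) : (cons t L Ls).toSub.get (inn Ts i) = L.toSub.get i := by
  rw [toSub_cons, inn, pair_sus, unsusp_suspVar]

theorem toSub_get_rst {k : ℕ} {T Ts : Tree} (t : Tm k) (L : Label k T) (Ls : Label k Ts)
    (i : Fin2 (Ts.size + 1)) : (cons t L Ls).toSub.get (rst T i) = Ls.toSub.get i := by
  rw [toSub_cons, pair_rst]
  rw [toSub_get_first, unsusp_south]

theorem ofSub_cons {k : ℕ} (T Ts : Tree) (σ : Sub ((Tree.cons T Ts).size + 1) k) :
    ofSub (.cons T Ts) σ = cons (σ.get (firstVar _)) (ofSub T ((Sub.ren (inn Ts)).comp σ))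
      (ofSub Ts ((Sub.ren (rst T)).comp σ)) := rfl

theorem toSub_ofSub {k : ℕ} : (T : Tree) → (σ : Sub (T.size + 1) k) → (ofSub T σ).toSub = σ
  | .nil, .snoc .nil _ => rfl
  | .cons T Ts, σ => by
    refine Sub.ext_get _ _ fun i => ?_
    rw [ofSub_cons]
    rcases cons_cases i with rfl | ⟨j, rfl⟩ | ⟨j, rfl⟩
    · rw [toSub_get_first]; rfl
    · rw [toSub_get_inn, toSub_ofSub T, Sub.get_comp, Sub.get_ren, Tm.sub]
    · rw [toSub_get_rst, toSub_ofSub Ts, Sub.get_comp, Sub.get_ren, Tm.sub]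

theorem first_setFirst {k : ℕ} (t : Tm k) : {T : Tree} → (L : Label k T) →
    (L.setFirst t).first = t
  | _, nil _ => rfl
  | _, cons _ _ _ => rfl

theorem toSub_setFirst_get {k : ℕ} (t : Tm k) : {T : Tree} → (L : Label k T) →
    (i : Fin2 (T.size + 1)) → i ≠ firstVar T.size → (L.setFirst t).toSub.get i = L.toSub.get i
  | _, nil _, .fz, h => absurd rfl h
  | _, cons s L Ls, i, h => by
    rw [setFirst]
    rcases cons_cases i with rfl | ⟨j, rfl⟩ | ⟨j, rfl⟩
    · exact absurd rfl h
    · rw [toSub_get_inn, toSub_get_inn]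
    · rw [toSub_get_rst, toSub_get_rst]

end Label

theorem ren_rst_comp_toSub {k : ℕ} {T Ts : Tree} (t : Tm k) (L : Label k T) (Ls : Label k Ts) :
    (Sub.ren (rst T)).comp (Label.cons t L Ls).toSub = Ls.toSub :=
  Sub.ext_get _ _ fun i => by
    rw [Sub.get_comp, Sub.get_ren, Tm.sub, Label.toSub_get_rst]

/-! ### Concatenation of trees -/

/-- A tree `A` presented as the concatenation of `T` and `Ss`, by the inclusions `l` and `r` of
these trees and a concatenation `ν` of labellings. With these as parameters, the recursive step
only has to mention trees of the form `cons T A`. -/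
structure AppendSpec (T Ss A : Tree) (l : Sub (T.size + 1) (A.size + 1))
    (r : Sub (Ss.size + 1) (A.size + 1)) (ν : ∀ {k}, Label k T → Label k Ss → Label k A) :
    Prop where
  left_first : l.get (firstVar T.size) = .var (firstVar A.size)
  isIncl_left : Sub.IsIncl A.ctx l T.ctx
  isIncl_right : Sub.IsIncl A.ctx r Ss.ctx
  right_first : r.get (firstVar Ss.size) = l.get T.lastVtx
  cases : ∀ i, (∃ j, l.get j = .var i) ∨ ∃ j, j ≠ firstVar Ss.size ∧ r.get j = .var i
  left_comp : ∀ {k} (M : Label k T) (Ls : Label k Ss), l.comp (ν M Ls).toSub = M.toSub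
  right_comp_get : ∀ {k} (M : Label k T) (Ls : Label k Ss) (i), i ≠ firstVar Ss.size →
    (r.comp (ν M Ls).toSub).get i = Ls.toSub.get i

theorem appendSpec_nil (Ss : Tree) {ν : ∀ {k}, Label k nil → Label k Ss → Label k Ss}
    (hν : ∀ {k} (t : Tm k) Ls, ν (.nil t) Ls = Ls.setFirst t) :
    AppendSpec nil Ss Ss (.snoc .nil (.var (firstVar Ss.size))) (Sub.id _) ν where
  left_first := rfl
  isIncl_left := fun | .fz => ⟨_, rfl, get_first Ss⟩
  isIncl_right := Sub.isIncl_id _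
  right_first := Sub.get_id _
  cases i := by
    by_cases h : i = firstVar Ss.size
    · exact .inl ⟨.fz, by rw [h]; rfl⟩
    · exact .inr ⟨i, h, Sub.get_id i⟩
  left_comp
    | .nil t, Ls => by
      refine Sub.ext_get _ _ fun | .fz => ?_
      rw [hν]
      exact (Label.toSub_get_first _).trans (Label.first_setFirst t Ls)
  right_comp_get
    | .nil t, Ls, i, h => by rw [hν, Sub.id_comp]; exact Label.toSub_setFirst_get t Ls i h

theorem AppendSpec.cons {Ts Ss A : Tree} {l : Sub (Ts.size + 1) (A.size + 1)}
    {r : Sub (Ss.size + 1) (A.size + 1)} {ν : ∀ {k}, Label k Ts → Label k Ss → Label k A}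
    (H : AppendSpec Ts Ss A l r ν) (T : Tree)
    {ν' : ∀ {k}, Label k (cons T Ts) → Label k Ss → Label k (cons T A)}
    (hν : ∀ {k} (t : Tm k) L Ls Ms, ν' (.cons t L Ls) Ms = .cons t L (ν Ls Ms)) :
    AppendSpec (cons T Ts) Ss (cons T A) (pair (Sub.ren (sus A)) (l.comp (Sub.ren (rst T))))
      (r.comp (Sub.ren (rst T))) ν' := by
  have hcompat : (l.comp (Sub.ren (rst T))).get (firstVar Ts.size) =
      (Sub.ren (sus A)).get (southVar (T.size + 1)) := by
    rw [Sub.get_comp, H.left_first, Tm.sub, Sub.get_ren, Sub.get_ren, sus_south]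
  have hfirst : ∀ {k} (M : Label k Ts) (Ls : Label k Ss), (ν M Ls).first = M.first := by
    intro k M Ls
    have := congrArg (Sub.get · (firstVar _)) (H.left_comp M Ls)
    simpa only [Sub.get_comp, H.left_first, Tm.sub, Label.toSub_get_first] using this
  refine ⟨?_, ?_, ?_, ?_, ?_, ?_, ?_⟩
  · rw [pair_first, Sub.get_ren, sus_north]
  · exact isIncl_pair hcompat (isIncl_sus T _) (H.isIncl_left.comp (isIncl_rst T _))
  · exact H.isIncl_right.comp (isIncl_rst T _)
  · rw [Sub.get_comp, H.right_first, ← Sub.get_comp]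
    exact (pair_rst hcompat _).symm
  · intro i
    rcases sus_or_rst i with ⟨j, rfl⟩ | ⟨j, rfl⟩
    · exact .inl ⟨sus Ts j, by rw [pair_sus, Sub.get_ren]⟩
    · rcases H.cases j with ⟨m, hm⟩ | ⟨m, hm, hm'⟩
      · refine .inl ⟨rst T m, ?_⟩
        rw [pair_rst hcompat, Sub.get_comp, hm, Tm.sub, Sub.get_ren]
      · exact .inr ⟨m, hm, by rw [Sub.get_comp, hm', Tm.sub, Sub.get_ren]⟩
  · rintro k (_ | ⟨t, M, Ms⟩) Ls
    rw [hν, pair_comp hcompat, Sub.comp_assoc, ren_rst_comp_toSub, H.left_comp,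
      Label.toSub_cons, Label.toSub_cons, ren_sus_comp_pair, hfirst]
  · rintro k (_ | ⟨t, M, Ms⟩) Ls i hi
    rw [hν, Sub.comp_assoc, ren_rst_comp_toSub, H.right_comp_get Ms Ls i hi]

theorem appendSpec : (T Ss : Tree) →
    AppendSpec T Ss (T.append Ss) (appL T Ss) (appR T Ss) Label.append
  | nil, Ss => appendSpec_nil Ss fun _ _ => rfl
  | cons T Ts, Ss => by
    have hl : appL (cons T Ts) Ss =
        pair (Sub.ren (sus (Ts.append Ss))) ((appL Ts Ss).comp (Sub.ren (rst T))) :=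
      congrArg (fun ρ => pair ρ ((appL Ts Ss).comp (Sub.ren (rst T)))) (Sub.id_comp _)
    rw [hl]
    exact (appendSpec Ts Ss).cons T fun _ _ _ _ => rfl

/-! ### The structure of an inserted tree -/

theorem Ty.mem_fv_sub_ren {m n : ℕ} (f : Fin2 m → Fin2 n) (A : Ty m) {j : Fin2 m} (hj : j ∈ A.fv) :
    f j ∈ (A.sub (Sub.ren f)).fv :=
  (Ty.mem_fv_sub A _ _).2 ⟨j, hj, by rw [Sub.get_ren]; rfl⟩

/-- The inserted substitution obtained from an insertion `ν` of labellings. -/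
def substOf {S T I : Tree} (ν : ∀ {k}, Label k S → Label k T → Label k I) {k : ℕ}
    (σ : Sub (S.size + 1) k) (τ : Sub (T.size + 1) k) : Sub (I.size + 1) k :=
  (ν (Label.ofSub S σ) (Label.ofSub T τ)).toSub

/-- A variable `j` of `S` is outer, with image `i`, with respect to an insertion if the exterior
substitution `κ` sends it to the variable `i`, preserving its type syntactically, and if each
inserted substitution `σ ≫_P τ` takes the value of `σ` there. -/
structure Outer {S T I : Tree} (κ : Sub (S.size + 1) (I.size + 1))
    (ν : ∀ {k}, Label k S → Label k T → Label k I) (j : Fin2 (S.size + 1))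
    (i : Fin2 (I.size + 1)) : Prop where
  get_exterior : κ.get j = .var i
  get_ctx : I.ctx.get i = (S.ctx.get j).sub κ
  get_substOf : ∀ {k} (σ : Sub (S.size + 1) k) (τ : Sub (T.size + 1) k),
    (substOf ν σ τ).get i = σ.get j

/-- What the recursion on the branch yields for an inserted tree `I` with exterior substitution `κ`,
interior substitution `ι` and inserted labellings `ν`: the square commutes syntactically on the type
and the top-dimensional variable of the disc; each variable of `S` lies in the disc of the branch or
is outer; and each variable of `I` comes from `T` or from an outer variable of `S`. -/
structure InsertSpec {S : Tree} (P : Branch S) (T I : Tree) (κ : Sub (S.size + 1) (I.size + 1))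
    (ι : Sub (T.size + 1) (I.size + 1)) (ν : ∀ {k}, Label k S → Label k T → Label k I) :
    Prop where
  isIncl : Sub.IsIncl I.ctx ι T.ctx
  interior_comp : ∀ {k} (σ : Sub (S.size + 1) k) (τ : Sub (T.size + 1) k),
    ι.comp (substOf ν σ τ) = τ
  ty_sub : P.ty.sub κ = (unbTy P.lh T).sub ι
  var_sub : κ.get P.var = (unbCoh P.lh T).sub ι
  exterior_first : κ.get (firstVar S.size) = .var (firstVar I.size)
  source_cases : ∀ j, (j = P.var ∨ j ∈ P.ty.fv) ∨ ∃ i, Outer κ ν j i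
  target_cases : ∀ i, (∃ j, ι.get j = .var i) ∨ ∃ j, Outer κ ν j i

theorem discSubN_cast_top {k n m : ℕ} {A : Ty k} (h : A.dim = n) (t : Tm k)
    (e : 2 * n + 1 = m + 1) : ((discSubN n A h t).cast e).get .fz = t := by
  obtain rfl : 2 * n = m := Nat.succ.inj e
  rfl

/-- The substitution `{𝒰_T^n, 𝒞_T^n}` sends the two vertices of the disc to the first and the last
vertex of `T`. -/
theorem unbSub_cast_ends (T : Tree) (n : ℕ) {m : ℕ} (e : 2 * (n + 1) + 1 = m + 2) :
    ((T.unbSub (n + 1)).cast e).get (northVar m) = .var (firstVar T.size) ∧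
      ((T.unbSub (n + 1)).cast e).get (southVar m) = .var T.lastVtx := by
  obtain rfl : 2 * n + 1 = m := Nat.succ.inj (Nat.succ.inj e)
  rw [unbSub_eq]
  exact toSubN_unbTy_ends T n

/-- At the end of the branch, the linear summand `Σ⌊S₀⌋` is the whole disc of the branch, and the
variables of `Ss` other than the first one are outer. -/
theorem insertSpec_here {S₀ Ss T A : Tree} (hS : S₀.IsLinear)
    {l : Sub (T.size + 1) (A.size + 1)} {r : Sub (Ss.size + 1) (A.size + 1)}
    {ν : ∀ {k}, Label k T → Label k Ss → Label k A} (H : AppendSpec T Ss A l r ν)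
    {ν' : ∀ {k}, Label k (cons S₀ Ss) → Label k T → Label k A}
    (hν : ∀ {k} (s : Tm k) L Ls M, ν' (.cons s L Ls) M = ν M Ls)
    (e : 2 * (S₀.dim + 1) + 1 = S₀.size + 2 + 1) :
    InsertSpec (Branch.here (Ss := Ss) hS) T A
      (pair (((T.unbSub (S₀.dim + 1)).cast e).comp l) r) l ν' := by
  have hl : (cons S₀ nil).IsLinear := isLinear_cons_nil.2 hS
  have hd : S₀.dim + 1 = (cons S₀ nil).dim := by simp [dim]
  have hμ : ∀ {k} (σ : Sub ((cons S₀ Ss).size + 1) k) τ, substOf ν' σ τ =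
      (ν (Label.ofSub T τ) (Label.ofSub Ss ((Sub.ren (rst S₀)).comp σ))).toSub :=
    fun σ τ => by rw [substOf, Label.ofSub_cons, hν]
  have hty : (Branch.here (Ss := Ss) hS).ty =
      ((cons S₀ nil).ctx.get .fz).sub (Sub.ren (sus Ss)) :=
    get_sus_susp Ss .fz
  have hvar : (Branch.here (Ss := Ss) hS).var = sus Ss .fz := rfl
  have hlh : (Branch.here (Ss := Ss) hS).lh = S₀.dim + 1 := by
    rw [Branch.lh, hty, Ty.dim_sub, hl.get_top, dim_unbTy, hd]
  have hcompat : r.get (firstVar Ss.size) =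
      (((T.unbSub (S₀.dim + 1)).cast e).comp l).get (southVar (S₀.size + 1)) := by
    rw [Sub.get_comp, (unbSub_cast_ends T S₀.dim e).2, H.right_first, Tm.sub]
  have hcast : (T.unbSub (S₀.dim + 1)).cast e = (discSubN (S₀.dim + 1) (unbTy (S₀.dim + 1) T)
      (dim_unbTy _ T) (unbCoh (S₀.dim + 1) T)).cast e := by
    rw [unbSub_eq]
  have houter : ∀ i j, i ≠ firstVar Ss.size → r.get i = .var j →
      Outer (pair (((T.unbSub (S₀.dim + 1)).cast e).comp l) r) ν' (rst S₀ i) j := by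
    intro i j hi hj
    refine ⟨(pair_rst hcompat i).trans hj, ?_, ?_⟩
    · obtain ⟨j', hj', hj''⟩ := H.isIncl_right i
      obtain rfl : j = j' := by rw [hj] at hj'; injection hj'
      rw [hj'', get_rst, Ty.sub_sub, ren_rst_comp_pair hcompat]
    · intro k σ τ
      rw [hμ]
      have := H.right_comp_get (Label.ofSub T τ)
        (Label.ofSub Ss ((Sub.ren (rst S₀)).comp σ)) i hi
      rw [Sub.get_comp, hj, Tm.sub, Label.toSub_ofSub, Sub.get_comp, Sub.get_ren, Tm.sub] at this
      exact this
  refine ⟨?_, ?_, ?_, ?_, ?_, ?_, ?_⟩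
  · exact H.isIncl_left
  · intro k σ τ
    rw [hμ, H.left_comp, Label.toSub_ofSub]
  · rw [hlh, hty, Ty.sub_sub]
    refine (congrArg (Ty.sub _) (ren_sus_comp_pair _ _)).trans ?_
    refine (Ty.sub_sub _ _ _).symm.trans ?_
    rw [hcast]
    exact congrArg (Ty.sub · l) (hl.get_top_sub hd _ _ _ e)
  · rw [hlh, hvar, pair_sus, hcast, Sub.get_comp]
    exact congrArg (Tm.sub · l) (discSubN_cast_top (m := S₀.size + 2) _ _ e)
  · rw [pair_first, Sub.get_comp, (unbSub_cast_ends T S₀.dim e).1, Tm.sub, H.left_first]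
  · have hsus : ∀ j, sus Ss j = (Branch.here (Ss := Ss) hS).var ∨
        sus Ss j ∈ (Branch.here (Ss := Ss) hS).ty.fv := by
      intro j
      rcases hl.eq_or_mem_fv j with rfl | hj
      · exact .inl rfl
      · exact .inr (by rw [hty]; exact Ty.mem_fv_sub_ren (sus Ss) _ hj)
    intro j
    rcases sus_or_rst j with ⟨j, rfl⟩ | ⟨j, rfl⟩
    · exact .inl (hsus j)
    · by_cases hj : j = firstVar Ss.size
      · rw [hj, ← sus_south]; exact .inl (hsus _)
      · obtain ⟨i, hi, -⟩ := H.isIncl_right j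
        exact .inr ⟨i, houter j i hj hi⟩
  · intro i
    rcases H.cases i with hi | ⟨j, hj, hj'⟩
    · exact .inl hi
    · exact .inr ⟨rst S₀ j, houter j i hj hj'⟩

/-- Going down a branch suspends the square: this is compatible with unbiased types and coherences,
the new boundary variables `N` and `S` belong to the disc, and the rest of the list is outer. -/
theorem InsertSpec.down {S₀ Ss T I : Tree} {P : Branch S₀} {κ : Sub (S₀.size + 1) (I.size + 1)}
    {ι : Sub (T.size + 1) (I.size + 1)} {ν : ∀ {k}, Label k S₀ → Label k T → Label k I}
    (H : InsertSpec P T I κ ι ν)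
    {ν' : ∀ {k}, Label k (cons S₀ Ss) → Label k (cons T nil) → Label k (cons I Ss)}
    (hν : ∀ {k} (s t₀ t₁ : Tm k) L Ls M,
      ν' (.cons s L Ls) (.cons t₀ M (.nil t₁)) = .cons t₀ (ν L M) (Ls.setFirst t₁)) :
    InsertSpec (Branch.down (Ss := Ss) P) (cons T nil) (cons I Ss)
      (pair (κ.susp.comp (Sub.ren (sus Ss))) (Sub.ren (rst I)))
      (ι.susp.comp (Sub.ren (sus Ss))) ν' := by
  have hμ : ∀ {k} (σ : Sub ((cons S₀ Ss).size + 1) k) (τ : Sub ((cons T nil).size + 1) k),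
      substOf ν' σ τ = (Label.cons (τ.get (firstVar _))
        (ν (Label.ofSub S₀ ((Sub.ren (inn Ss)).comp σ))
          (Label.ofSub T ((Sub.ren (inn nil)).comp τ)))
        ((Label.ofSub Ss ((Sub.ren (rst S₀)).comp σ)).setFirst
          (τ.get (southVar (T.size + 1))))).toSub := by
    intro k σ τ
    have hs : ((Sub.ren (rst T (Ts := nil))).comp τ).get .fz = τ.get (southVar (T.size + 1)) := by
      rw [Sub.get_comp, Sub.get_ren, Tm.sub]; rfl
    rw [substOf, Label.ofSub_cons, Label.ofSub_cons, ← hs]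
    exact congrArg Label.toSub (hν _ _ _ _ _ _)
  have hcompat : (Sub.ren (rst I)).get (firstVar Ss.size) =
      (κ.susp.comp (Sub.ren (sus Ss))).get (southVar (S₀.size + 1)) := by
    rw [Sub.get_ren, Sub.get_comp, Sub.susp_get_south, Tm.sub, Sub.get_ren, sus_south]
  have hty : (Branch.down (Ss := Ss) P).ty = P.ty.susp.sub (Sub.ren (sus Ss)) := get_inn Ss P.var
  have hvar : (Branch.down (Ss := Ss) P).var = inn Ss P.var := rfl
  have hlh : (Branch.down (Ss := Ss) P).lh = P.lh + 1 := by
    rw [Branch.lh, hty, Ty.dim_sub, Ty.dim_susp]; rfl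
  have hinn : ∀ j i, Outer κ ν j i →
      Outer (pair (κ.susp.comp (Sub.ren (sus Ss))) (Sub.ren (rst I))) ν' (inn Ss j) (inn Ss i) := by
    rintro j i ⟨hi, hi', hi''⟩
    refine ⟨?_, ?_, ?_⟩
    · rw [inn, pair_sus, Sub.get_comp, Sub.susp_get, hi, Tm.susp, Tm.sub, Sub.get_ren]; rfl
    · rw [get_inn, hi', get_inn, Ty.sub_sub, ren_sus_comp_pair, ← Ty.sub_sub, Ty.susp_sub]
    · intro k σ τ
      rw [hμ, Label.toSub_get_inn]
      refine (hi'' _ _).trans ?_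
      rw [Sub.get_comp, Sub.get_ren, Tm.sub]
  have hrst : ∀ j, j ≠ firstVar Ss.size →
      Outer (pair (κ.susp.comp (Sub.ren (sus Ss))) (Sub.ren (rst I))) ν' (rst S₀ j) (rst I j) := by
    intro j hj
    refine ⟨by rw [pair_rst hcompat, Sub.get_ren], ?_, ?_⟩
    · rw [get_rst, get_rst, Ty.sub_sub, ren_rst_comp_pair hcompat]
    · intro k σ τ
      rw [hμ, Label.toSub_get_rst, Label.toSub_setFirst_get _ _ _ hj, Label.toSub_ofSub,
        Sub.get_comp, Sub.get_ren, Tm.sub]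
  have hι_north : (ι.susp.comp (Sub.ren (sus Ss))).get (northVar (T.size + 1)) =
      .var (firstVar _) := by
    rw [Sub.get_comp, Sub.susp_get_north, Tm.sub, Sub.get_ren, sus_north]
  have hι_south : (ι.susp.comp (Sub.ren (sus Ss))).get (southVar (T.size + 1)) =
      .var (rst I (firstVar _)) := by
    rw [Sub.get_comp, Sub.susp_get_south, Tm.sub, Sub.get_ren, sus_south]
  have hι_susp : ∀ j i, ι.get j = .var i →
      (ι.susp.comp (Sub.ren (sus Ss))).get (suspVar j) = .var (inn Ss i) := by
    intro j i hi
    rw [Sub.get_comp, Sub.susp_get, hi, Tm.susp, Tm.sub, Sub.get_ren]; rfl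
  refine ⟨?_, ?_, ?_, ?_, ?_, ?_, ?_⟩
  · exact H.isIncl.susp.comp (isIncl_sus _ _)
  · intro k σ τ
    -- The value of the composite at a variable that `ι` sends to the variable `i`.
    have hcomp : ∀ j i, (ι.susp.comp (Sub.ren (sus Ss))).get j = .var i →
        ((ι.susp.comp (Sub.ren (sus Ss))).comp (substOf ν' σ τ)).get j =
          (substOf ν' σ τ).get i := by
      intro j i hi
      rw [Sub.get_comp, hi, Tm.sub]
    refine Sub.ext_susp (m := T.size + 1) ?_ ?_ fun j => ?_
    · refine (hcomp _ _ hι_north).trans ?_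
      rw [hμ, Label.toSub_get_first]
      exact congrArg τ.get (sus_north T nil).symm
    · refine (hcomp _ _ hι_south).trans ?_
      rw [hμ, Label.toSub_get_rst, Label.toSub_get_first, Label.first_setFirst]; rfl
    · obtain ⟨i, hi, -⟩ := H.isIncl j
      refine (hcomp _ _ (hι_susp j i hi)).trans ?_
      rw [hμ, Label.toSub_get_inn]
      have := congrArg (Sub.get · j) (H.interior_comp ((Sub.ren (inn Ss)).comp σ)
        ((Sub.ren (inn nil)).comp τ))
      simp only [Sub.get_comp, hi, Tm.sub, Sub.get_ren] at this
      exact this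
  · rw [hlh, unbTy_susp, hty, Ty.sub_sub, ren_sus_comp_pair, ← Ty.sub_sub, ← Ty.susp_sub,
      H.ty_sub, Ty.susp_sub, Ty.sub_sub]; rfl
  · rw [hlh, unbCoh_susp, hvar, inn, pair_sus, Sub.get_comp, Sub.susp_get, H.var_sub,
      Tm.susp_sub, Tm.sub_sub]; rfl
  · rw [pair_first, Sub.get_comp, Sub.susp_get_north, Tm.sub, Sub.get_ren, sus_north]
  · have hfv : ∀ j, j ∈ P.ty.susp.fv → sus Ss j ∈ (Branch.down (Ss := Ss) P).ty.fv := by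
      intro j hj
      rw [hty]; exact Ty.mem_fv_sub_ren (sus Ss) _ hj
    intro j
    rcases cons_cases j with rfl | ⟨j, rfl⟩ | ⟨j, rfl⟩
    · rw [← sus_north]; exact .inl (.inr (hfv _ (Ty.ends_mem_fv_susp _).1))
    · rcases H.source_cases j with (rfl | hj) | ⟨i, hj⟩
      · exact .inl (.inl rfl)
      · exact .inl (.inr (hfv _ (Ty.suspVar_mem_fv _ hj)))
      · exact .inr ⟨_, hinn j i hj⟩
    · by_cases hj : j = firstVar Ss.size
      · rw [hj, ← sus_south]; exact .inl (.inr (hfv _ (Ty.ends_mem_fv_susp _).2))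
      · exact .inr ⟨_, hrst j hj⟩
  · intro i
    rcases cons_cases i with rfl | ⟨i, rfl⟩ | ⟨i, rfl⟩
    · exact .inl ⟨_, hι_north⟩
    · rcases H.target_cases i with ⟨j, hj⟩ | ⟨j, hj⟩
      · exact .inl ⟨_, hι_susp j i hj⟩
      · exact .inr ⟨_, hinn j i hj⟩
    · by_cases hi : i = firstVar Ss.size
      · rw [hi]; exact .inl ⟨_, hι_south⟩
      · exact .inr ⟨_, hrst i hi⟩

/-- Going right along a list of trees adds a summand whose variables are outer; its last vertex,
being the first variable of the remaining list, is as it is there. -/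
theorem InsertSpec.right {S₀ Ss T I : Tree} {P : Branch Ss} {κ : Sub (Ss.size + 1) (I.size + 1)}
    {ι : Sub (T.size + 1) (I.size + 1)} {ν : ∀ {k}, Label k Ss → Label k T → Label k I}
    (H : InsertSpec P T I κ ι ν)
    {ν' : ∀ {k}, Label k (cons S₀ Ss) → Label k T → Label k (cons S₀ I)}
    (hν : ∀ {k} (s : Tm k) L Ls M, ν' (.cons s L Ls) M = .cons s L (ν Ls M)) :
    InsertSpec (Branch.right (S₀ := S₀) P) T (cons S₀ I)
      (pair (Sub.ren (sus I)) (κ.comp (Sub.ren (rst S₀)))) (ι.comp (Sub.ren (rst S₀))) ν' := by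
  have hμ : ∀ {k} (σ : Sub ((cons S₀ Ss).size + 1) k) (τ : Sub (T.size + 1) k),
      substOf ν' σ τ =
      (Label.cons (σ.get (firstVar _)) (Label.ofSub S₀ ((Sub.ren (inn Ss)).comp σ))
        (ν (Label.ofSub Ss ((Sub.ren (rst S₀)).comp σ)) (Label.ofSub T τ))).toSub :=
    fun σ τ => by rw [substOf, Label.ofSub_cons, hν]
  have hcompat : (κ.comp (Sub.ren (rst S₀))).get (firstVar Ss.size) =
      (Sub.ren (sus I)).get (southVar (S₀.size + 1)) := by
    rw [Sub.get_comp, H.exterior_first, Tm.sub, Sub.get_ren, Sub.get_ren, sus_south]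
  have hty : (Branch.right (S₀ := S₀) P).ty = P.ty.sub (Sub.ren (rst S₀)) := get_rst S₀ P.var
  have hvar : (Branch.right (S₀ := S₀) P).var = rst S₀ P.var := rfl
  have hlh : (Branch.right (S₀ := S₀) P).lh = P.lh := by
    rw [Branch.lh, hty, Ty.dim_sub]; rfl
  have hsus : ∀ j, (∀ {k} (σ : Sub ((cons S₀ Ss).size + 1) k) (τ : Sub (T.size + 1) k),
      (substOf ν' σ τ).get (sus I j) = σ.get (sus Ss j)) →
      Outer (pair (Sub.ren (sus I)) (κ.comp (Sub.ren (rst S₀)))) ν' (sus Ss j) (sus I j) := by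
    intro j hj
    refine ⟨by rw [pair_sus, Sub.get_ren], ?_, hj⟩
    rw [get_sus_susp, get_sus_susp, Ty.sub_sub, ren_sus_comp_pair]
  have hfirst := hsus (northVar (S₀.size + 1)) fun σ τ => by
    rw [hμ, sus_north, sus_north, Label.toSub_get_first]; rfl
  have hinn : ∀ j, Outer (pair (Sub.ren (sus I)) (κ.comp (Sub.ren (rst S₀)))) ν' (inn Ss j)
      (inn I j) := by
    intro j
    refine hsus _ fun σ τ => ?_
    rw [hμ]
    refine (Label.toSub_get_inn _ _ _ j).trans ?_
    rw [Label.toSub_ofSub, Sub.get_comp, Sub.get_ren, Tm.sub]; rfl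
  have hrst : ∀ j i, Outer κ ν j i →
      Outer (pair (Sub.ren (sus I)) (κ.comp (Sub.ren (rst S₀)))) ν' (rst S₀ j) (rst S₀ i) := by
    rintro j i ⟨hi, hi', hi''⟩
    refine ⟨by rw [pair_rst hcompat, Sub.get_comp, hi, Tm.sub, Sub.get_ren], ?_, ?_⟩
    · rw [get_rst, hi', get_rst, Ty.sub_sub, Ty.sub_sub, ren_rst_comp_pair hcompat]
    · intro k σ τ
      rw [hμ, Label.toSub_get_rst]
      refine (hi'' _ _).trans ?_
      rw [Sub.get_comp, Sub.get_ren, Tm.sub]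
  refine ⟨?_, ?_, ?_, ?_, ?_, ?_, ?_⟩
  · exact H.isIncl.comp (isIncl_rst _ _)
  · intro k σ τ
    rw [hμ, Sub.comp_assoc, ren_rst_comp_toSub]
    exact H.interior_comp _ τ
  · rw [hlh, hty, Ty.sub_sub, ren_rst_comp_pair hcompat, ← Ty.sub_sub, H.ty_sub, Ty.sub_sub]
  · rw [hlh, hvar, pair_rst hcompat, Sub.get_comp, H.var_sub, Tm.sub_sub]
  · rw [pair_first, Sub.get_ren, sus_north]
  · intro j
    rcases cons_cases j with rfl | ⟨j, rfl⟩ | ⟨j, rfl⟩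
    · rw [← sus_north]; exact .inr ⟨_, hfirst⟩
    · exact .inr ⟨_, hinn j⟩
    · rcases H.source_cases j with (rfl | hj) | ⟨i, hj⟩
      · exact .inl (.inl rfl)
      · exact .inl (.inr (by rw [hty]; exact Ty.mem_fv_sub_ren (rst S₀) _ hj))
      · exact .inr ⟨_, hrst j i hj⟩
  · intro i
    rcases cons_cases i with rfl | ⟨i, rfl⟩ | ⟨i, rfl⟩
    · rw [← sus_north]; exact .inr ⟨_, hfirst⟩
    · exact .inr ⟨_, hinn i⟩
    · rcases H.target_cases i with ⟨j, hj⟩ | ⟨j, hj⟩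
      · exact .inl ⟨j, by rw [Sub.get_comp, hj, Tm.sub, Sub.get_ren]⟩
      · exact .inr ⟨_, hrst j i hj⟩

theorem insertSpec {S : Tree} (P : Branch S) : ∀ (T : Tree) (h : P.bh ≤ T.th),
    InsertSpec P T (insert P T h) (exterior P T h) (interior P T h) (Label.insert P T h) := by
  induction P with
  | here hS =>
    exact fun T h => insertSpec_here hS (appendSpec T _) (fun _ _ _ _ => rfl) _
  | @down S₀ Ss P ih =>
    intro T h
    match T, h with
    | nil, h => exact absurd h (Nat.not_succ_le_zero _)
    | cons T nil, h =>
      have hκ : exterior (Branch.down (Ss := Ss) P) (cons T nil) h =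
          pair ((exterior P T (Nat.le_of_succ_le_succ h)).susp.comp (Sub.ren (sus Ss)))
            (Sub.ren (rst (insert P T (Nat.le_of_succ_le_succ h)))) :=
        congrArg (pair _) (Sub.id_comp _)
      rw [hκ]
      exact (ih T (Nat.le_of_succ_le_succ h)).down fun _ _ _ _ _ _ => rfl
    | cons _ (cons _ _), h => exact absurd h (Nat.not_succ_le_zero _)
  | @right S₀ Ss P ih =>
    intro T h
    have hκ : exterior (Branch.right (S₀ := S₀) P) T h =
        pair (Sub.ren (sus (insert P T h))) ((exterior P T h).comp (Sub.ren (rst S₀))) :=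
      congrArg (fun ρ => pair ρ ((exterior P T h).comp (Sub.ren (rst S₀)))) (Sub.id_comp _)
    rw [hκ]
    exact (ih T h).right fun _ _ _ _ => rfl

theorem Branch.lh_ne_zero {S : Tree} (P : Branch S) : P.lh ≠ 0 := by
  induction P with
  | @here S₀ Ss _ =>
    have : (S₀.ctx.susp.get .fz).dim ≠ 0 := by
      rw [show S₀.ctx.susp.get .fz = (S₀.ctx.get .fz).susp from Ctx.susp_get S₀.ctx .fz,
        Ty.dim_susp]
      exact Nat.succ_ne_zero _
    rwa [← Ty.dim_sub _ (Sub.ren (sus Ss)), ← get_sus_susp] at this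
  | @down S₀ Ss P _ =>
    rw [Branch.lh, show (Branch.down (Ss := Ss) P).ty = _ from get_inn Ss P.var, Ty.dim_sub,
      Ty.dim_susp]
    exact Nat.succ_ne_zero _
  | @right S₀ Ss P ih =>
    rw [Branch.lh, show (Branch.right (S₀ := S₀) P).ty = _ from get_rst S₀ P.var, Ty.dim_sub]
    exact ih

/-! ### The universal property -/

theorem EqSub.of_get : {m n : ℕ} → {Γ : Ctx n} → {σ τ : Sub m n} →
    (∀ i, EqTm R Γ (σ.get i) (τ.get i)) → EqSub R Γ σ τ
  | _, _, _, .nil, .nil, _ => .nil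
  | _, _, _, .snoc _ _, .snoc _ _, h => .snoc (EqSub.of_get fun i => h (.fs i)) (h .fz)

theorem Branch.dim_ty {S : Tree} (P : Branch S) : P.ty.dim = P.lh := rfl

/-- The substitution `{A, P} : Dⁿ → S` of a branch `P` with type `A`. -/
def Branch.discIncl {S : Tree} (P : Branch S) : Sub (2 * P.lh + 1) (S.size + 1) :=
  discSubN P.lh P.ty P.dim_ty (.var P.var)

theorem Branch.isIncl_disc {S : Tree} (P : Branch S) :
    Sub.IsIncl S.ctx P.discIncl (disc P.lh) :=
  isIncl_discSubN S.ctx_glob P.lh P.var rfl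

/-- Every variable in the disc of a branch `P` is a value of `{A, P}`, with the corresponding
type. -/
theorem Branch.exists_get_disc {S : Tree} (P : Branch S) {j : Fin2 (S.size + 1)}
    (hj : j = P.var ∨ j ∈ P.ty.fv) : ∃ d, P.discIncl.get d = .var j ∧
      S.ctx.get j = ((disc P.lh).get d).sub P.discIncl := by
  have key : ∃ d, P.discIncl.get d = .var j := by
    rcases hj with rfl | hj
    · exact ⟨.fz, rfl⟩
    · obtain ⟨d, hd⟩ := Ty.Glob.exists_get_toSubN P.lh P.ty rfl (S.ctx_glob.get P.var) j hj
      exact ⟨.fs d, hd⟩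
  obtain ⟨d, hd⟩ := key
  obtain ⟨j', hj', hj''⟩ := P.isIncl_disc d
  obtain rfl : j = j' := by rw [hd] at hj'; injection hj'
  exact ⟨d, hd, hj''⟩

/-- If a term is a value both of the top-dimensional variable of the branch and of the unbiased
coherence, then uniqueness of types shows that the boundaries agree too. -/
theorem eqSub_of_top_eq [R.Tame] {S T : Tree} (P : Branch S) (hT : T.dim ≤ P.lh) {n : ℕ}
    {Γ : Ctx n} {σ : Sub (S.size + 1) n} {τ : Sub (T.size + 1) n} (hσ : WfSub R Γ σ S.ctx)
    (hτ : WfSub R Γ τ T.ctx) (h : (Tm.var P.var).sub σ = (T.unbCoh P.lh).sub τ) :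
    EqSub R Γ (P.discIncl.comp σ) ((T.unbSub P.lh).comp τ) := by
  have h1 : HasTy R Γ ((Tm.var P.var).sub σ) (P.ty.sub σ) := (HasTy.var P.var S.wf).sub hσ
  have h2 : HasTy R Γ ((T.unbCoh P.lh).sub τ) ((unbTy P.lh T).sub τ) := by
    obtain ⟨m, hm⟩ := Nat.exists_eq_succ_of_ne_zero P.lh_ne_zero
    rw [hm] at hT ⊢
    exact (unbCoh_hasTy_of hT (unbTy_wf _ T)).sub hτ
  rw [← h] at h2
  rw [Branch.discIncl, unbSub_eq, discSubN_comp, discSubN_comp, ← h]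
  exact .snoc ((h1.eqTy h2).toSubN _ _ _) (EqTm.refl _ _)

namespace InsertSpec

variable {S T I : Tree} {P : Branch S} {κ : Sub (S.size + 1) (I.size + 1)}
  {ι : Sub (T.size + 1) (I.size + 1)} {ν : ∀ {k}, Label k S → Label k T → Label k I}

theorem square (H : InsertSpec P T I κ ι ν) :
    P.discIncl.comp κ = (T.unbSub P.lh).comp ι := by
  rw [Branch.discIncl, unbSub_eq, discSubN_comp, discSubN_comp]
  exact discSubN_congr _ _ H.ty_sub H.var_sub

theorem wf_interior (H : InsertSpec P T I κ ι ν) : WfSub R I.ctx ι T.ctx :=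
  H.isIncl.wf T.wf I.wf

theorem wf_exterior [R.Tame] (H : InsertSpec P T I κ ι ν) (hT : T.dim ≤ P.lh) :
    WfSub R I.ctx κ S.ctx := by
  refine WfSub.of_get S.wf fun j => ?_
  rcases H.source_cases j with hj | ⟨i, hi⟩
  · obtain ⟨d, hd, hd'⟩ := P.exists_get_disc hj
    have := (WfSub.comp (unbSub_wf P.lh_ne_zero hT) (H.wf_interior (R := R))).get_hasTy d
    rwa [← H.square, Sub.get_comp, hd, ← Ty.sub_sub, ← hd'] at this
  · rw [hi.get_exterior, ← hi.get_ctx]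
    exact .var i I.wf

/-- On the disc of the branch the inserted substitution of a cocone is determined by `τ`, so that
there it agrees with `σ` only up to definitional equality. -/
theorem exterior_comp (H : InsertSpec P T I κ ι ν) {n : ℕ} {Γ : Ctx n} {σ : Sub (S.size + 1) n}
    {τ : Sub (T.size + 1) n}
    (h : EqSub R Γ (P.discIncl.comp σ) ((T.unbSub P.lh).comp τ)) :
    EqSub R Γ (κ.comp (substOf ν σ τ)) σ := by
  refine EqSub.of_get fun j => ?_
  rcases H.source_cases j with hj | ⟨i, hi⟩
  · obtain ⟨d, hd, -⟩ := P.exists_get_disc hj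
    have e1 : (κ.comp (substOf ν σ τ)).get j = ((T.unbSub P.lh).comp τ).get d := by
      have := congrArg (fun ρ => (ρ.comp (substOf ν σ τ)).get d) H.square
      rwa [Sub.comp_assoc, Sub.comp_assoc, H.interior_comp, Sub.get_comp, hd, Tm.sub] at this
    have e2 : (P.discIncl.comp σ).get d = σ.get j := by
      rw [Sub.get_comp, hd, Tm.sub]
    rw [e1, ← e2]
    exact (h.get d).symm
  · rw [Sub.get_comp, hi.get_exterior, Tm.sub, hi.get_substOf]
    exact EqTm.refl _ _

theorem wf_substOf (H : InsertSpec P T I κ ι ν) {n : ℕ} {Γ : Ctx n} {σ : Sub (S.size + 1) n}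
    {τ : Sub (T.size + 1) n} (hσ : WfSub R Γ σ S.ctx) (hτ : WfSub R Γ τ T.ctx)
    (h : EqSub R Γ (P.discIncl.comp σ) ((T.unbSub P.lh).comp τ)) :
    WfSub R Γ (substOf ν σ τ) I.ctx := by
  refine WfSub.of_get I.wf fun i => ?_
  rcases H.target_cases i with ⟨j, hj⟩ | ⟨j, hj⟩
  · obtain ⟨i', hi', hi''⟩ := H.isIncl j
    obtain rfl : i = i' := by rw [hj] at hi'; injection hi'
    have e : (substOf ν σ τ).get i = (ι.comp (substOf ν σ τ)).get j := by
      rw [Sub.get_comp, hj, Tm.sub]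
    rw [hi'', Ty.sub_sub, e, H.interior_comp]
    exact hτ.get_hasTy j
  · rw [hj.get_substOf, hj.get_ctx, Ty.sub_sub]
    exact .conv (hσ.get_hasTy j) (EqTy.congr _ (H.exterior_comp h).symm)

/-- The exterior and interior substitutions are jointly epimorphic, since every variable of the
inserted tree is a value of one of them. -/
theorem eqSub_of_comp (H : InsertSpec P T I κ ι ν) {n : ℕ} {Γ : Ctx n}
    {μ μ' : Sub (I.size + 1) n} (hκ : EqSub R Γ (κ.comp μ) (κ.comp μ'))
    (hι : EqSub R Γ (ι.comp μ) (ι.comp μ')) : EqSub R Γ μ μ' := by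
  refine EqSub.of_get fun i => ?_
  rcases H.target_cases i with ⟨j, hj⟩ | ⟨j, hj⟩
  · simpa only [Sub.get_comp, hj, Tm.sub] using hι.get j
  · simpa only [Sub.get_comp, hj.get_exterior, Tm.sub] using hκ.get j

end InsertSpec

end Catt

open CategoryTheory
theorem mainTheorem4 (R : Catt.RuleSet) [R.Tame] (S T : Catt.Tree) (P : Catt.Branch S)
    (hbh : P.bh ≤ T.th) (hlh : T.dim ≤ P.lh) :
    ∃ (wfD : Catt.WfCtx R (Catt.disc P.lh)) (wfS : Catt.WfCtx R S.ctx) (wfT : Catt.WfCtx R T.ctx)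
      (wfI : Catt.WfCtx R (Catt.insert P T hbh).ctx)
      (wfP : Catt.WfSub R S.ctx (Catt.discSub P.ty (.var P.var)) (Catt.disc P.lh))
      (wfU : Catt.WfSub R T.ctx (T.unbSub P.lh) (Catt.disc P.lh))
      (wfκ : Catt.WfSub R (Catt.insert P T hbh).ctx (Catt.exterior P T hbh) S.ctx)
      (wfι : Catt.WfSub R (Catt.insert P T hbh).ctx (Catt.interior P T hbh) T.ctx),
      let D : Catt.Obj R := ⟨_, Catt.disc P.lh, wfD⟩
      let S' : Catt.Obj R := ⟨_, S.ctx, wfS⟩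
      let T' : Catt.Obj R := ⟨_, T.ctx, wfT⟩
      let I : Catt.Obj R := ⟨_, (Catt.insert P T hbh).ctx, wfI⟩
      let p : D ⟶ S' := Catt.Obj.hom (Catt.discSub P.ty (.var P.var)) wfP
      let u : D ⟶ T' := Catt.Obj.hom (T.unbSub P.lh) wfU
      let κ : S' ⟶ I := Catt.Obj.hom (Catt.exterior P T hbh) wfκ
      let ι : T' ⟶ I := Catt.Obj.hom (Catt.interior P T hbh) wfι
      ∃ po : IsPushout p u κ ι,
        ∀ (Γ : Catt.Obj R) (σ : Catt.Sub (S.size + 1) Γ.len) (τ : Catt.Sub (T.size + 1) Γ.len)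
          (wfσ : Catt.WfSub R Γ.ctx σ S.ctx) (wfτ : Catt.WfSub R Γ.ctx τ T.ctx),
          let f : S' ⟶ Γ := Catt.Obj.hom σ wfσ
          let g : T' ⟶ Γ := Catt.Obj.hom τ wfτ
          ((Catt.Tm.var P.var).sub σ = (T.unbCoh P.lh).sub τ →
            p ≫ f = u ≫ g) ∧
          ∀ w : p ≫ f = u ≫ g,
            ∃ wfμ : Catt.WfSub R Γ.ctx (Catt.insertSub P T hbh σ τ) (Catt.insert P T hbh).ctx,
              po.desc f g w = Catt.Obj.hom (Δ := I) (Catt.insertSub P T hbh σ τ) wfμ := by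
  have H := Catt.insertSpec P T hbh
  refine ⟨Catt.disc_wf _, S.wf, T.wf, (Catt.insert P T hbh).wf,
    P.isIncl_disc.wf (Catt.disc_wf _) S.wf, Catt.Tree.unbSub_wf P.lh_ne_zero hlh,
    H.wf_exterior hlh, H.wf_interior, ?_⟩
  intro D S' T' I p u κ ι
  -- The morphism that the inserted substitution of a cocone represents.
  have fac : ∀ (Γ : Catt.Obj R) (σ : Catt.Sub (S.size + 1) Γ.len)
      (τ : Catt.Sub (T.size + 1) Γ.len) (wfσ : Catt.WfSub R Γ.ctx σ S.ctx)
      (wfτ : Catt.WfSub R Γ.ctx τ T.ctx),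
      p ≫ Catt.Obj.hom (Δ := S') σ wfσ = u ≫ Catt.Obj.hom (Δ := T') τ wfτ →
      ∃ wfμ : Catt.WfSub R Γ.ctx (Catt.insertSub P T hbh σ τ) I.ctx,
        κ ≫ Catt.Obj.hom (Δ := I) _ wfμ = Catt.Obj.hom (Δ := S') σ wfσ ∧
        ι ≫ Catt.Obj.hom (Δ := I) _ wfμ = Catt.Obj.hom (Δ := T') τ wfτ := by
    intro Γ σ τ wfσ wfτ w
    have w' := Quotient.exact w
    exact ⟨H.wf_substOf wfσ wfτ w', Quotient.sound (H.exterior_comp w'),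
      congrArg (Quotient.mk _) (Subtype.ext (H.interior_comp σ τ))⟩
  have uniq : ∀ (Γ : Catt.Obj R) (m m' : I ⟶ Γ), κ ≫ m = κ ≫ m' → ι ≫ m = ι ≫ m' → m = m' := by
    rintro Γ ⟨μ⟩ ⟨μ'⟩ h h'
    exact Quotient.sound (H.eqSub_of_comp (Quotient.exact h) (Quotient.exact h'))
  have lift : ∀ (Γ : Catt.Obj R) (f : S' ⟶ Γ) (g : T' ⟶ Γ), p ≫ f = u ≫ g →
      ∃ m : I ⟶ Γ, κ ≫ m = f ∧ ι ≫ m = g := by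
    rintro Γ ⟨σ, wfσ⟩ ⟨τ, wfτ⟩ w
    obtain ⟨_, h, h'⟩ := fac Γ σ τ wfσ wfτ w
    exact ⟨_, h, h'⟩
  have sq : p ≫ κ = u ≫ ι := congrArg (Quotient.mk _) (Subtype.ext H.square)
  choose m hm hm' using fun s : Limits.PushoutCocone p u => lift s.pt s.inl s.inr s.condition
  have po : IsPushout p u κ ι := ⟨⟨sq⟩, ⟨Limits.PushoutCocone.IsColimit.mk sq m hm hm'
    fun s m' h h' => uniq _ _ _ (h.trans (hm s).symm) (h'.trans (hm' s).symm)⟩⟩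
  refine ⟨po, fun Γ σ τ wfσ wfτ =>
    ⟨fun h => Quotient.sound (Catt.eqSub_of_top_eq P hlh wfσ wfτ h), fun w => ?_⟩⟩
  obtain ⟨wfμ, h, h'⟩ := fac Γ σ τ wfσ wfτ w
  exact ⟨wfμ, uniq _ _ _ ((po.inl_desc _ _ _).trans h.symm) ((po.inr_desc _ _ _).trans h'.symm)⟩
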